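/- Let $(\xi_{k,n})_{k,n\in\mathbb N}$ be i.i.d. random variables with values in $\mathbb N=\{0,1,2,\dots\}$ and let $(I_n)_{n\in\mathbb N}$ be i.i.d. random variables with values in $\mathbb N$, the two families being independent of each other. Assume that $\mathbb E(\xi_{1,1})=1$, $\mathrm{Var}(\xi_{1,1})=d>0$, $\mathbb E(I_1)=c>0$, and that $\mathbb E(\xi_{1,1}^{2+\delta})<\infty$ and $\mathbb E(I_1^{2+\delta})<\infty$ for some $\delta>0$. Let $(X_n)_{n\in\mathbb N}$ be the critical Galton–Watson process with immigration $$X_{n+1}=\sum_{k=1}^{X_n}\xi_{k,n}+I_n ,$$ write $\mathbb P_{x_0}$ for its law when $X_0=x_0\in\mathbb N$, and for $A>0$ put $\tau_A=\inf\{n\in\mathbb N: X_n\le A\}$ (with $\inf\emptyset=\infty$). Assume that $\theta=\frac{2c}{d}<1$. Then there exists $A>0$ such that for every integer $x_0>A$ and all real $\alpha,\beta$ with $\alpha<1-\theta<\beta$ there exist constants $C_\alpha,C_\beta>0$ such that for all integers $n\ge 1$ $$\frac{C_\beta}{n^{\beta}}\le \mathbb P_{x_0}(\tau_A>n)\le\frac{C_\alpha}{n^{\alpha}}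 .$$ -/

import Mathlib

open MeasureTheory ProbabilityTheory

/-- The Galton-Watson process with immigration started from `x₀` individuals, driven by the
offspring numbers `ξ k n` (of the `k`-th individual of generation `n`) and the immigration
numbers `I n`:  `X 0 = x₀` and `X (n + 1) = ∑_{k = 1}^{X n} ξ k n + I n`. -/
def gwImmigration {Ω : Type*} (ξ : ℕ → ℕ → Ω → ℕ) (I : ℕ → Ω → ℕ) (x₀ : ℕ) : ℕ → Ω → ℕ
  | 0, _ => x₀
  | n + 1, ω => ∑ k ∈ Finset.Icc 1 (gwImmigration ξ I x₀ n ω), ξ k n ω + I n ω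

/-- The hitting time `τ_A = inf {n ∈ ℕ : X n ≤ A}` of `[0, A]` by an `ℕ`-valued process `X`, with
value `⊤` (infinity) where `X` never enters `[0, A]`. -/
noncomputable def hitBelow {Ω : Type*} (X : ℕ → Ω → ℕ) (A : ℝ) : Ω → WithTop ℕ :=
  hittingAfter X {m : ℕ | (m : ℝ) ≤ A} 0

/-! With θ = 2c/d and s = 1 - θ, a Taylor expansion of `x ^ p` for 0 < p < 1 gives E[X₁^p | X₀ = x]
= x^p + (pd/2)(p - s) x^(p-1) + o(x^(p-1)) (`exists_integral_gwStep_rpow_expansion`). So x^p has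
negative drift of order x^(p-1) for p < s and positive drift for p > s, once x is large.

Upper bound. Let p < s and let W be comparable to x^p with drift at most -κ x^(p-1) above A. Summing
the drift inequality bounds both E[W(X_k); τ > k] and ∑ E[κ X_k^(p-1); τ > k] by W(x₀). Using the
second bound where X_k ≤ n and the first where X_k ≥ n gives ∑_{k<n} P(τ > k) ≤ D n^(1-p)
(`sum_gwSurvival_le`). Since P(τ > k) decreases in k, P(τ > n) ≤ D n^(-p).

Lower bound. Let q > s. The killed process keeps E[X_n^q; τ > n] ≥ g > 0
(`exists_le_setLIntegral_rpow`), while E[X_n; τ > n] ≤ x₀ + c ∑_{k<n} P(τ > k) = O(n^(1-p)) by the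
upper bound. A fractional moment bounded below against a first moment bounded above forces P(τ > n)
≥ C n^(-q(1-p)/(1-q)), and the exponent tends to s as p and q tend to s
(`exists_le_measureReal_gwSurvival`).

The level A has to be fixed before α and β. `exists_lyapunov` achieves this for the upper bound by
adding to x^p a multiple of one fixed smaller power. -/

/-! ### Taylor remainder and truncated second moments of independent sums. -/

-- The remainder is cubic near 0 and quadratic far away. In this truncated form its expectation is
-- controlled by second moments alone.
open Filter Topology in
theorem exists_rpow_one_add_expansion_bound {p : ℝ} (hp0 : 0 < p) (hp1 : p < 1) :
    ∃ C : ℝ, 0 < C ∧ ∀ u : ℝ, -1 ≤ u →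
      |(1 + u) ^ p - (1 + p * u + p * (p - 1) / 2 * u ^ 2)| ≤ C * (u ^ 2 * min 1 |u|) := by
  have h := (Real.one_add_rpow_hasFPowerSeriesAt_zero (a := p)).isBigO_sub_partialSum_pow 3
  obtain ⟨K, hK0, hK⟩ := h.exists_pos
  rw [Asymptotics.isBigOWith_iff, Metric.eventually_nhds_iff] at hK
  obtain ⟨η, hη, hK⟩ := hK
  have hpoly : ∀ u : ℝ, FormalMultilinearSeries.partialSum (binomialSeries ℝ p) 3 u =
      1 + p * u + p * (p - 1) / 2 * u ^ 2 := by
    intro u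
    have hc : Ring.choose p 2 = p * (p - 1) / 2 := by
      rw [Ring.choose_eq_smul]
      simp [descPochhammer_succ_right, Polynomial.smeval_mul, Polynomial.smeval_sub,
        Polynomial.smeval_X]
      ring
    simp [FormalMultilinearSeries.partialSum, Finset.sum_range_succ, binomialSeries, hc]
    ring
  set m : ℝ := min 1 η
  have hm : 0 < m := lt_min one_pos hη
  -- `K` serves the range |u| < m, where the power series applies. For |u| ≥ m the crude bound
  -- 5u²/m² is at most (5/m³) u² min(1, |u|).
  refine ⟨K + 5 / m ^ 3, by positivity, fun u hu => ?_⟩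
  rcases lt_or_ge |u| m with hum | hum
  · have h1 := @hK u (by simpa using lt_of_lt_of_le hum (min_le_right _ _))
    rw [zero_add, hpoly, Real.norm_eq_abs, Real.norm_eq_abs] at h1
    have hu1 : |u| ≤ 1 := hum.le.trans (min_le_left _ _)
    rw [min_eq_right hu1]
    refine h1.trans ?_
    have : |‖u‖ ^ 3| = u ^ 2 * |u| := by
      rw [Real.norm_eq_abs, abs_of_nonneg (by positivity), ← sq_abs u]; ring
    rw [this]
    have : 0 ≤ 5 / m ^ 3 * (u ^ 2 * |u|) := by positivity
    linarith
  · have hm1 : m ≤ 1 := min_le_left _ _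
    have h1 : (1 + u) ^ p ≤ 2 + |u| := by
      rcases le_total (1 + u) 1 with h | h
      · have := Real.rpow_le_one (by linarith : 0 ≤ 1 + u) h hp0.le
        have := abs_nonneg u
        linarith
      · have := Real.rpow_le_rpow_of_exponent_le h hp1.le
        rw [Real.rpow_one] at this
        have := le_abs_self u
        linarith
    have h0 : 0 ≤ (1 + u) ^ p := Real.rpow_nonneg (by linarith) p
    have hpu : |p * u| ≤ |u| := by
      rw [abs_mul, abs_of_pos hp0]; nlinarith [abs_nonneg u]
    have hpu2 : |p * (p - 1) / 2 * u ^ 2| ≤ u ^ 2 := by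
      rw [abs_mul, abs_of_nonneg (sq_nonneg u)]
      have : |p * (p - 1) / 2| ≤ 1 := by rw [abs_le]; constructor <;> nlinarith
      nlinarith [sq_nonneg u]
    have hL : |(1 + u) ^ p - (1 + p * u + p * (p - 1) / 2 * u ^ 2)| ≤ 2 + 2 * |u| + u ^ 2 := by
      rw [abs_le] at *
      have := abs_nonneg u
      constructor <;> linarith [hpu.1, hpu.2, hpu2.1, hpu2.2, sq_nonneg u]
    have hmin : m ≤ min 1 |u| := le_min hm1 hum
    have hv : 1 ≤ |u| / m := by rwa [le_div_iff₀ hm, one_mul]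
    have hvu : |u| ≤ |u| / m := by
      rw [le_div_iff₀ hm]; nlinarith [abs_nonneg u]
    have h3 : 2 + 2 * |u| + u ^ 2 ≤ 4 / m ^ 2 * u ^ 2 + u ^ 2 := by
      have : 4 / m ^ 2 * u ^ 2 = 4 * (|u| / m) ^ 2 := by
        rw [div_pow, sq_abs]; ring
      rw [this]
      nlinarith [abs_nonneg u]
    have h4 : 5 / m ^ 2 * u ^ 2 ≤ (K + 5 / m ^ 3) * (u ^ 2 * min 1 |u|) := by
      calc 5 / m ^ 2 * u ^ 2 = 5 / m ^ 3 * (u ^ 2 * m) := by field_simp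
        _ ≤ 5 / m ^ 3 * (u ^ 2 * min 1 |u|) := by gcongr
        _ ≤ _ := by gcongr; linarith
    have h5 : u ^ 2 ≤ 1 / m ^ 2 * u ^ 2 := by
      refine le_mul_of_one_le_left (sq_nonneg u) ?_
      rw [le_div_iff₀ (by positivity)]; nlinarith
    calc _ ≤ 4 / m ^ 2 * u ^ 2 + 1 / m ^ 2 * u ^ 2 := by linarith
      _ = 5 / m ^ 2 * u ^ 2 := by ring
      _ ≤ _ := h4

/-- Increment bound for a ↦ a min(1, r|a|), used to remove one summand from a sum: b is that summand
and a the rest. -/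
theorem abs_mul_min_sub_le {r : ℝ} (hr : 0 ≤ r) (a b : ℝ) :
    |(a + b) * min 1 (r * |a + b|) - a * min 1 (r * |a|)| ≤
      |b| * (2 * r * |a| + min 1 (r * |b|)) := by
  have h1 : min 1 (r * |a + b|) ≤ r * |a| + min 1 (r * |b|) := by
    have := abs_add_le a b
    have h2 : r * |a + b| ≤ r * |a| + r * |b| := by nlinarith
    have h3 : 0 ≤ r * |a| := by positivity
    rcases le_total 1 (r * |b|) with h | h
    · rw [min_eq_left h]; exact (min_le_left _ _).trans (by linarith)
    · rw [min_eq_right h]; exact (min_le_right _ _).trans h2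
  have h2 : |min 1 (r * |a + b|) - min 1 (r * |a|)| ≤ r * |b| := by
    refine (abs_min_sub_min_le_max _ _ _ _).trans ?_
    have h3 : abs (r * |a + b| - r * |a|) ≤ r * |b| := by
      rw [← mul_sub, abs_mul, abs_of_nonneg hr]
      refine mul_le_mul_of_nonneg_left ?_ hr
      simpa using abs_abs_sub_abs_le (a + b) a
    exact max_le (by simpa using by positivity) h3
  have h0 : 0 ≤ min 1 (r * |a + b|) := le_min zero_le_one (by positivity)
  calc |(a + b) * min 1 (r * |a + b|) - a * min 1 (r * |a|)|
      = |b * min 1 (r * |a + b|) + a * (min 1 (r * |a + b|) - min 1 (r * |a|))| := by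
        congr 1; ring
    _ ≤ |b| * min 1 (r * |a + b|) + |a| * |min 1 (r * |a + b|) - min 1 (r * |a|)| := by
        refine (abs_add_le _ _).trans ?_
        rw [abs_mul, abs_mul, abs_of_nonneg h0]
    _ ≤ |b| * (r * |a| + min 1 (r * |b|)) + |a| * (r * |b|) := by gcongr
    _ = _ := by ring

theorem sq_mul_min_add_le {r : ℝ} (hr : 0 ≤ r) (a b : ℝ) :
    (a + b) ^ 2 * min 1 (r * |a + b|) ≤
      8 * (a ^ 2 * min 1 (r * |a|)) + 8 * (b ^ 2 * min 1 (r * |b|)) := by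
  have key : ∀ a b : ℝ, |b| ≤ |a| →
      (a + b) ^ 2 * min 1 (r * |a + b|) ≤ 8 * (a ^ 2 * min 1 (r * |a|)) := by
    intro a b hab
    have h1 : |a + b| ≤ 2 * |a| := (abs_add_le a b).trans (by linarith)
    have h2 : (a + b) ^ 2 ≤ 4 * a ^ 2 := by
      rw [← sq_abs (a + b), ← sq_abs a]; nlinarith [abs_nonneg (a + b)]
    have h3 : min 1 (r * |a + b|) ≤ 2 * min 1 (r * |a|) := by
      have : r * |a + b| ≤ 2 * (r * |a|) := by nlinarith
      rcases le_total 1 (r * |a|) with h | h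
      · rw [min_eq_left h]; exact (min_le_left _ _).trans (by linarith)
      · rw [min_eq_right h]; exact (min_le_right _ _).trans this
    have h0 : 0 ≤ min 1 (r * |a + b|) := le_min zero_le_one (by positivity)
    calc _ ≤ 4 * a ^ 2 * (2 * min 1 (r * |a|)) := by gcongr
      _ = _ := by ring
  have hn : ∀ a : ℝ, 0 ≤ 8 * (a ^ 2 * min 1 (r * |a|)) := fun a => by positivity
  rcases le_total |b| |a| with h | h
  · linarith [key a b h, hn b]
  · have := key b a h
    rw [add_comm b a] at this
    linarith [hn a]

theorem integrable_sq_mul_min {Ω : Type*} [MeasurableSpace Ω] {μ : Measure Ω}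
    {Y : Ω → ℝ} (hY : MemLp Y 2 μ) {r : ℝ} (hr : 0 ≤ r) :
    Integrable (fun ω => Y ω ^ 2 * min 1 (r * |Y ω|)) μ := by
  refine Integrable.mono hY.integrable_sq ?_ (ae_of_all _ fun ω => ?_)
  · have := hY.1
    exact ((this.pow 2).mul (aestronglyMeasurable_const.inf (this.norm.const_mul r)))
  · rw [Real.norm_eq_abs, Real.norm_eq_abs, abs_mul]
    refine mul_le_of_le_one_right (abs_nonneg _) ?_
    rw [abs_of_nonneg (le_min zero_le_one (by positivity))]
    exact min_le_left _ _

theorem integral_abs_le_sqrt {Ω : Type*} [MeasurableSpace Ω] {μ : Measure Ω}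
    [IsProbabilityMeasure μ]
    {T : Ω → ℝ} (hT : MemLp T 2 μ) :
    ∫ ω, |T ω| ∂μ ≤ √(∫ ω, T ω ^ 2 ∂μ) := by
  refine Real.le_sqrt_of_sq_le ?_
  have h1 : MemLp (fun ω => |T ω|) 2 μ := hT.abs
  have h2 := variance_eq_sub h1
  have h3 := variance_nonneg (fun ω => |T ω|) μ
  simp only [Pi.pow_apply, sq_abs] at h2
  linarith

theorem integral_sum_sq_of_iIndepFun {Ω : Type*} [MeasurableSpace Ω] {μ : Measure Ω}
    [IsProbabilityMeasure μ]
    {ι : Type*} {Y : ι → Ω → ℝ} (hY : iIndepFun Y μ)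
    (h2 : ∀ i, MemLp (Y i) 2 μ) (h0 : ∀ i, ∫ ω, Y i ω ∂μ = 0) (s : Finset ι) :
    ∫ ω, (∑ i ∈ s, Y i ω) ^ 2 ∂μ = ∑ i ∈ s, ∫ ω, Y i ω ^ 2 ∂μ := by
  have h1 := IndepFun.variance_sum (s := s) (fun i _ => h2 i)
    (fun i _ j _ hij => hY.indepFun hij)
  have h3 : ∫ ω, (∑ i ∈ s, Y i) ω ∂μ = 0 := by
    simp only [Finset.sum_apply]
    rw [integral_finsetSum _ fun i _ => (h2 i).integrable one_le_two]
    simp [h0]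
  rw [variance_of_integral_eq_zero (memLp_finsetSum' _ fun i _ => h2 i).1.aemeasurable h3] at h1
  simp only [Finset.sum_apply] at h1
  rw [h1]
  exact Finset.sum_congr rfl fun i _ =>
    variance_of_integral_eq_zero (h2 i).1.aemeasurable (h0 i)

/-- Leave-one-out argument. With G(a) = a min(1, r|a|), the integrand is ∑ Y_i G(S). As T_i = S -
Y_i is independent of the centred Y_i, E[Y_i G(T_i)] = 0, so only the increment G(S) - G(T_i)
contributes. -/
theorem integral_sum_sq_mul_min_le {Ω : Type*} [MeasurableSpace Ω] {μ : Measure Ω}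
    [IsProbabilityMeasure μ]
    {ι : Type*} {Y : ι → Ω → ℝ} (hY : iIndepFun Y μ)
    (hm : ∀ i, Measurable (Y i)) (h2 : ∀ i, MemLp (Y i) 2 μ) (h0 : ∀ i, ∫ ω, Y i ω ∂μ = 0)
    (s : Finset ι) {r : ℝ} (hr : 0 ≤ r) :
    ∫ ω, (∑ i ∈ s, Y i ω) ^ 2 * min 1 (r * |∑ i ∈ s, Y i ω|) ∂μ ≤
      ∑ i ∈ s, (2 * r * (∫ ω, Y i ω ^ 2 ∂μ) * √(∑ j ∈ s, ∫ ω, Y j ω ^ 2 ∂μ) +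
        ∫ ω, Y i ω ^ 2 * min 1 (r * |Y i ω|) ∂μ) := by
  classical
  set S : Ω → ℝ := fun ω => ∑ i ∈ s, Y i ω with hS
  set T : ι → Ω → ℝ := fun i ω => ∑ j ∈ s.erase i, Y j ω with hT
  let G : ℝ → ℝ := fun a => a * min 1 (r * |a|)
  have hG : Measurable G := by fun_prop
  have hGle : ∀ a, ‖G a‖ ≤ ‖a‖ := fun a => by
    rw [norm_mul]
    refine mul_le_of_le_one_right (norm_nonneg _) ?_
    rw [Real.norm_of_nonneg (le_min zero_le_one (by positivity))]
    exact min_le_left _ _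
  have hGm : ∀ Z : Ω → ℝ, MemLp Z 2 μ → MemLp (fun ω => G (Z ω)) 2 μ := fun Z hZ =>
    hZ.mono (hG.comp_aemeasurable hZ.1.aemeasurable).aestronglyMeasurable
      (ae_of_all _ fun ω => hGle _)
  have hS2 : MemLp S 2 μ := memLp_finsetSum _ fun i _ => h2 i
  have hT2 : ∀ i, MemLp (T i) 2 μ := fun i => memLp_finsetSum _ fun i _ => h2 i
  have hind : ∀ i, IndepFun (T i) (Y i) μ := fun i => by
    have := hY.indepFun_finsetSum_of_notMem hm (s := s.erase i) (i := i) (by simp)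
    convert this using 1
    ext ω; simp [hT]
  have hvar : ∀ i, ∫ ω, T i ω ^ 2 ∂μ ≤ ∑ j ∈ s, ∫ ω, Y j ω ^ 2 ∂μ := fun i => by
    rw [integral_sum_sq_of_iIndepFun hY h2 h0]
    exact Finset.sum_le_sum_of_subset_of_nonneg (Finset.erase_subset _ _)
      fun j _ _ => integral_nonneg fun ω => sq_nonneg _
  have habs : ∀ i, ∫ ω, |T i ω| ∂μ ≤ √(∑ j ∈ s, ∫ ω, Y j ω ^ 2 ∂μ) := fun i =>
    (integral_abs_le_sqrt (hT2 i)).trans (Real.sqrt_le_sqrt (hvar i))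
  have hmain : ∀ i ∈ s, ∫ ω, Y i ω * G (S ω) ∂μ ≤
      2 * r * (∫ ω, Y i ω ^ 2 ∂μ) * √(∑ j ∈ s, ∫ ω, Y j ω ^ 2 ∂μ) +
        ∫ ω, Y i ω ^ 2 * min 1 (r * |Y i ω|) ∂μ := by
    intro i hi
    have hzero : ∫ ω, Y i ω * G (T i ω) ∂μ = 0 := by
      have := ((hind i).comp hG measurable_id).symm.integral_fun_mul_eq_mul_integral
        (h2 i).1 (hGm _ (hT2 i)).1
      simp only [Function.comp_apply, id_eq, h0 i, zero_mul] at this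
      exact this
    have hi1 : Integrable (fun ω => Y i ω * G (S ω)) μ := (h2 i).integrable_mul (hGm _ hS2)
    have hi2 : Integrable (fun ω => Y i ω * G (T i ω)) μ := (h2 i).integrable_mul (hGm _ (hT2 i))
    have hind' : IndepFun (fun ω => Y i ω ^ 2) (fun ω => |T i ω|) μ :=
      ((hind i).comp (φ := fun x => |x|) (ψ := fun x => x ^ 2) (by fun_prop) (by fun_prop)).symm
    have hi3 : Integrable (fun ω => Y i ω ^ 2 * |T i ω|) μ :=
      hind'.integrable_mul (h2 i).integrable_sq ((hT2 i).integrable one_le_two).abs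
    have hi4 := integrable_sq_mul_min (h2 i) hr
    calc ∫ ω, Y i ω * G (S ω) ∂μ = ∫ ω, (Y i ω * G (S ω) - Y i ω * G (T i ω)) ∂μ := by
          rw [integral_sub hi1 hi2, hzero, sub_zero]
      _ ≤ ∫ ω, (2 * r * (Y i ω ^ 2 * |T i ω|) + Y i ω ^ 2 * min 1 (r * |Y i ω|)) ∂μ := by
          refine integral_mono (hi1.sub hi2) ((hi3.const_mul _).add hi4) fun ω => ?_
          have hST : S ω = T i ω + Y i ω := by
            simp only [hS, hT]; exact (Finset.sum_erase_add _ _ hi).symm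
          have := abs_mul_min_sub_le hr (T i ω) (Y i ω)
          calc Y i ω * G (S ω) - Y i ω * G (T i ω) = Y i ω * (G (S ω) - G (T i ω)) := by ring
            _ ≤ |Y i ω| * |G (S ω) - G (T i ω)| := by
              rw [← abs_mul]; exact le_abs_self _
            _ ≤ |Y i ω| * (|Y i ω| * (2 * r * |T i ω| + min 1 (r * |Y i ω|))) := by
              rw [hST]; gcongr
            _ = |Y i ω| ^ 2 * (2 * r * |T i ω| + min 1 (r * |Y i ω|)) := by ring
            _ = _ := by rw [sq_abs]; ring
      _ = 2 * r * ((∫ ω, Y i ω ^ 2 ∂μ) * ∫ ω, |T i ω| ∂μ) +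
            ∫ ω, Y i ω ^ 2 * min 1 (r * |Y i ω|) ∂μ := by
          rw [integral_add (hi3.const_mul _) hi4, integral_const_mul]
          congr 2
          exact hind'.integral_fun_mul_eq_mul_integral (h2 i).integrable_sq.1
            ((hT2 i).integrable one_le_two).abs.1
      _ ≤ _ := by
          have h5 : 0 ≤ ∫ ω, Y i ω ^ 2 ∂μ := integral_nonneg fun ω => sq_nonneg _
          rw [mul_assoc (2 * r)]
          gcongr
          exact habs i
  calc _ = ∫ ω, ∑ i ∈ s, Y i ω * G (S ω) ∂μ := by
        congr 1; ext ω
        rw [← Finset.sum_mul]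
        simp only [hS, G]; ring
    _ = ∑ i ∈ s, ∫ ω, Y i ω * G (S ω) ∂μ :=
        integral_finsetSum _ fun i _ => (h2 i).integrable_mul (hGm _ hS2)
    _ ≤ _ := Finset.sum_le_sum hmain

/-! ### The noise, its independence and its σ-algebras. -/

/-- The joint family of offspring and immigration numbers. -/
def gwNoise {Ω : Type*} (ξ : ℕ → ℕ → Ω → ℕ) (I : ℕ → Ω → ℕ) : (ℕ × ℕ) ⊕ ℕ → Ω → ℕ :=
  Sum.elim (fun p => ξ p.1 p.2) I

/-- Independent offspring and immigration numbers with finite second moments; the offspring law has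
mean `1` and variance `d`, the immigration law has mean `c`. -/
structure IsCriticalGW {Ω : Type*} [MeasurableSpace Ω] (μ : Measure Ω)
    (ξ : ℕ → ℕ → Ω → ℕ) (I : ℕ → Ω → ℕ) (c d : ℝ) : Prop where
  measurable : ∀ i, Measurable (gwNoise ξ I i)
  indep : iIndepFun (gwNoise ξ I) μ
  offspring_ident : ∀ k n, IdentDistrib (ξ k n) (ξ 1 1) μ μ
  immigration_ident : ∀ n, IdentDistrib (I n) (I 1) μ μ
  offspring_memLp : MemLp (fun ω => (ξ 1 1 ω : ℝ)) 2 μ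
  immigration_memLp : MemLp (fun ω => (I 1 ω : ℝ)) 2 μ
  offspring_mean : ∫ ω, (ξ 1 1 ω : ℝ) ∂μ = 1
  offspring_var : ∫ ω, ((ξ 1 1 ω : ℝ) - 1) ^ 2 ∂μ = d
  immigration_mean : ∫ ω, (I 1 ω : ℝ) ∂μ = c

/-- Merging both families into a single independent one makes the σ-algebras of disjoint index sets
independent, which is all the Markov property needs. -/
theorem iIndepFun_sumElim {Ω ι κ β : Type*} [MeasurableSpace Ω] [MeasurableSpace β]
    {μ : Measure Ω} [IsProbabilityMeasure μ] {f : ι → Ω → β} {g : κ → Ω → β}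
    (hf : iIndepFun f μ) (hg : iIndepFun g μ)
    (hfg : IndepFun (fun ω i => f i ω) (fun ω k => g k ω) μ) :
    iIndepFun (Sum.elim f g) μ := by
  rw [iIndepFun_iff_measure_inter_preimage_eq_mul]
  intro S sets hsets
  have h1 := hf.measure_inter_preimage_eq_mul S.toLeft (sets := fun i => sets (Sum.inl i))
    fun i hi => hsets _ (by simpa using hi)
  have h2 := hg.measure_inter_preimage_eq_mul S.toRight (sets := fun i => sets (Sum.inr i))
    fun i hi => hsets _ (by simpa using hi)
  have h3 := hfg.measure_inter_preimage_eq_mul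
    {u | ∀ i ∈ S.toLeft, u i ∈ sets (Sum.inl i)} {u | ∀ i ∈ S.toRight, u i ∈ sets (Sum.inr i)} ?_ ?_
  · have e1 : (fun ω i => f i ω) ⁻¹' {u | ∀ i ∈ S.toLeft, u i ∈ sets (Sum.inl i)} =
        ⋂ i ∈ S.toLeft, f i ⁻¹' sets (Sum.inl i) := by ext; simp
    have e2 : (fun ω i => g i ω) ⁻¹' {u | ∀ i ∈ S.toRight, u i ∈ sets (Sum.inr i)} =
        ⋂ i ∈ S.toRight, g i ⁻¹' sets (Sum.inr i) := by ext; simp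
    rw [e1, e2, h1, h2] at h3
    have e3 : ⋂ i ∈ S, Sum.elim f g i ⁻¹' sets i =
        (⋂ i ∈ S.toLeft, f i ⁻¹' sets (Sum.inl i)) ∩
          ⋂ i ∈ S.toRight, g i ⁻¹' sets (Sum.inr i) := by
      ext ω; simp
    rw [e3, h3]
    conv_rhs => rw [← Finset.toLeft_disjSum_toRight (u := S), Finset.prod_disjSum]
    simp
  · rw [show {u : ι → β | ∀ i ∈ S.toLeft, u i ∈ sets (Sum.inl i)} =
      ⋂ i ∈ S.toLeft, (fun u => u i) ⁻¹' sets (Sum.inl i) by ext; simp]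
    exact Finset.measurableSet_biInter _ fun i hi =>
      measurable_pi_apply i (hsets _ (by simpa using hi))
  · rw [show {u : κ → β | ∀ i ∈ S.toRight, u i ∈ sets (Sum.inr i)} =
      ⋂ i ∈ S.toRight, (fun u => u i) ⁻¹' sets (Sum.inr i) by ext; simp]
    exact Finset.measurableSet_biInter _ fun i hi =>
      measurable_pi_apply i (hsets _ (by simpa using hi))

theorem MeasureTheory.memLp_two_of_integrable_rpow {Ω : Type*} [MeasurableSpace Ω] {μ : Measure Ω}
    {Z : Ω → ℕ} (hZ : Measurable Z) {δ : ℝ} (hδ : 0 ≤ δ)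
    (h : Integrable (fun ω => (Z ω : ℝ) ^ (2 + δ)) μ) : MemLp (fun ω => (Z ω : ℝ)) 2 μ := by
  have hm : AEStronglyMeasurable (fun ω => (Z ω : ℝ)) μ :=
    (measurable_from_top.comp hZ).aestronglyMeasurable
  rw [memLp_two_iff_integrable_sq hm]
  refine h.mono (hm.pow 2) (ae_of_all _ fun ω => ?_)
  rw [Real.norm_of_nonneg (by positivity), Real.norm_of_nonneg (by positivity)]
  rcases Nat.eq_zero_or_pos (Z ω) with h0 | h0
  · rw [h0]; simp; positivity
  · rw [← Real.rpow_two]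
    exact Real.rpow_le_rpow_of_exponent_le (by exact_mod_cast h0) (by linarith)

/-- The `σ`-algebra generated by the offspring and immigration numbers with index in `S`. -/
abbrev gwSigma {Ω : Type*} (ξ : ℕ → ℕ → Ω → ℕ) (I : ℕ → Ω → ℕ) (S : Set ((ℕ × ℕ) ⊕ ℕ)) :
    MeasurableSpace Ω :=
  ⨆ i ∈ S, MeasurableSpace.comap (gwNoise ξ I i) inferInstance

theorem measurable_gwNoise_gwSigma {Ω : Type*} (ξ : ℕ → ℕ → Ω → ℕ) (I : ℕ → Ω → ℕ)
    {S : Set ((ℕ × ℕ) ⊕ ℕ)} {i : (ℕ × ℕ) ⊕ ℕ} (hi : i ∈ S) :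
    Measurable[gwSigma ξ I S] (gwNoise ξ I i) :=
  measurable_iff_comap_le.2 (le_iSup₂_of_le i hi le_rfl)

theorem gwSigma_mono {Ω : Type*} (ξ : ℕ → ℕ → Ω → ℕ) (I : ℕ → Ω → ℕ)
    {S T : Set ((ℕ × ℕ) ⊕ ℕ)} (h : S ⊆ T) : gwSigma ξ I S ≤ gwSigma ξ I T :=
  biSup_mono h

namespace IsCriticalGW

variable {Ω : Type*} [MeasurableSpace Ω] {μ : Measure Ω} {ξ : ℕ → ℕ → Ω → ℕ} {I : ℕ → Ω → ℕ}
  {c d : ℝ}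

theorem gwSigma_le (h : IsCriticalGW μ ξ I c d) (S : Set ((ℕ × ℕ) ⊕ ℕ)) :
    gwSigma ξ I S ≤ ‹MeasurableSpace Ω› :=
  iSup₂_le fun i _ => (h.measurable i).comap_le

theorem indep_gwSigma (h : IsCriticalGW μ ξ I c d) {S T : Set ((ℕ × ℕ) ⊕ ℕ)}
    (hST : Disjoint S T) : Indep (gwSigma ξ I S) (gwSigma ξ I T) μ :=
  indep_iSup_of_disjoint (fun i => (h.measurable i).comap_le) h.indep.iIndep hST

theorem measurable_offspring (h : IsCriticalGW μ ξ I c d) (k n : ℕ) : Measurable (ξ k n) :=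
  h.measurable (Sum.inl (k, n))

end IsCriticalGW

/-- The size of the next generation if the `n`-th generation has `x` individuals. -/
def gwStep {Ω : Type*} (ξ : ℕ → ℕ → Ω → ℕ) (I : ℕ → Ω → ℕ) (n x : ℕ) (ω : Ω) : ℕ :=
  ∑ k ∈ Finset.Icc 1 x, ξ k n ω + I n ω

/-- The indices of the noise up to generation `n`, exclusively. -/
def gwPast (n : ℕ) : Set ((ℕ × ℕ) ⊕ ℕ) :=
  {i | Sum.elim Prod.snd id i < n}

/-- The indices of the noise of generation `n`. -/
def gwPresent (n : ℕ) : Set ((ℕ × ℕ) ⊕ ℕ) :=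
  {i | Sum.elim Prod.snd id i = n}

theorem measurable_gwStep_gwSigma {Ω : Type*} (ξ : ℕ → ℕ → Ω → ℕ) (I : ℕ → Ω → ℕ) (n x : ℕ) :
    Measurable[gwSigma ξ I (gwPresent n)] (gwStep ξ I n x) := by
  let _ := gwSigma ξ I (gwPresent n)
  refine Measurable.add (Finset.measurable_fun_sum _ fun k _ => ?_) ?_
  · exact measurable_gwNoise_gwSigma ξ I (i := Sum.inl (k, n)) rfl
  · exact measurable_gwNoise_gwSigma ξ I (i := Sum.inr n) rfl

theorem measurable_gwImmigration_gwSigma {Ω : Type*} (ξ : ℕ → ℕ → Ω → ℕ) (I : ℕ → Ω → ℕ)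
    (x₀ n : ℕ) : Measurable[gwSigma ξ I (gwPast n)] (gwImmigration ξ I x₀ n) := by
  induction n with
  | zero => exact @measurable_const _ _ _ (_) _
  | succ n ih =>
    let _ := gwSigma ξ I (gwPast (n + 1))
    have h1 : Measurable (gwImmigration ξ I x₀ n) :=
      ih.mono (gwSigma_mono ξ I fun i hi => Nat.lt_succ_of_lt hi) le_rfl
    have h2 : ∀ x, Measurable (gwStep ξ I n x) := fun x =>
      (measurable_gwStep_gwSigma ξ I n x).mono
        (gwSigma_mono ξ I fun i hi => Nat.lt_succ_of_le (le_of_eq hi)) le_rfl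
    -- The random number of summands is harmless because the state space is countable.
    have h3 : Measurable fun ω => gwStep ξ I n (gwImmigration ξ I x₀ n ω) ω :=
      (measurable_from_prod_countable_right (f := fun p : ℕ × Ω => gwStep ξ I n p.1 p.2) h2).comp (h1.prodMk measurable_id)
    exact h3

/-! ### Moments of one step and the expansion of its fractional powers. -/

namespace IsCriticalGW

variable {Ω : Type*} [MeasurableSpace Ω] {μ : Measure Ω}
  {ξ : ℕ → ℕ → Ω → ℕ} {I : ℕ → Ω → ℕ} {c d : ℝ}

/-- The centred sum of the offspring numbers of the first `x` individuals of generation `n`. -/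
def centredSum (ξ : ℕ → ℕ → Ω → ℕ) (n x : ℕ) (ω : Ω) : ℝ :=
  ∑ k ∈ Finset.Icc 1 x, ((ξ k n ω : ℝ) - 1)

omit [MeasurableSpace Ω] in
theorem gwStep_eq_centredSum (n x : ℕ) (ω : Ω) :
    (gwStep ξ I n x ω : ℝ) = x + (centredSum ξ n x ω + I n ω) := by
  simp [gwStep, centredSum]
  ring

theorem centred_iIndepFun (h : IsCriticalGW μ ξ I c d) (n : ℕ) :
    iIndepFun (fun k ω => (ξ k n ω : ℝ) - 1) μ :=
  (h.indep.precomp (g := fun k : ℕ => Sum.inl (k, n)) fun a b hab => by simpa using hab).comp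
    (fun _ m => (m : ℝ) - 1) fun _ => measurable_from_top

theorem centred_ident (h : IsCriticalGW μ ξ I c d) (k n : ℕ) :
    IdentDistrib (fun ω => (ξ k n ω : ℝ) - 1) (fun ω => (ξ 1 1 ω : ℝ) - 1) μ μ :=
  (h.offspring_ident k n).comp (u := fun m : ℕ => (m : ℝ) - 1) measurable_from_top

theorem immigration_ident' (h : IsCriticalGW μ ξ I c d) (n : ℕ) :
    IdentDistrib (fun ω => (I n ω : ℝ)) (fun ω => (I 1 ω : ℝ)) μ μ :=
  (h.immigration_ident n).comp (u := fun m : ℕ => (m : ℝ)) measurable_from_top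

theorem centred_measurable (h : IsCriticalGW μ ξ I c d) (k n : ℕ) :
    Measurable (fun ω => (ξ k n ω : ℝ) - 1) :=
  (measurable_from_top (f := fun m : ℕ => (m : ℝ) - 1)).comp (h.measurable_offspring k n)

theorem centred_memLp [IsProbabilityMeasure μ]
     (h : IsCriticalGW μ ξ I c d) (k n : ℕ) :
    MemLp (fun ω => (ξ k n ω : ℝ) - 1) 2 μ :=
  (h.centred_ident k n).memLp_iff.2 (h.offspring_memLp.sub (memLp_const 1))

theorem immigration_memLp' (h : IsCriticalGW μ ξ I c d) (n : ℕ) :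
    MemLp (fun ω => (I n ω : ℝ)) 2 μ :=
  (h.immigration_ident' n).memLp_iff.2 h.immigration_memLp

theorem integral_centred [IsProbabilityMeasure μ]
    (h : IsCriticalGW μ ξ I c d) (k n : ℕ) :
    ∫ ω, ((ξ k n ω : ℝ) - 1) ∂μ = 0 := by
  rw [(h.centred_ident k n).integral_eq,
    integral_sub (h.offspring_memLp.integrable one_le_two) (integrable_const _), h.offspring_mean]
  simp

theorem integral_centred_sq (h : IsCriticalGW μ ξ I c d) (k n : ℕ) :
    ∫ ω, ((ξ k n ω : ℝ) - 1) ^ 2 ∂μ = d := by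
  rw [← h.offspring_var]
  exact ((h.centred_ident k n).comp (u := fun y => y ^ 2) (by fun_prop)).integral_eq

theorem integral_centred_sq_mul_min (h : IsCriticalGW μ ξ I c d) (k n : ℕ) (r : ℝ) :
    ∫ ω, ((ξ k n ω : ℝ) - 1) ^ 2 * min 1 (r * |(ξ k n ω : ℝ) - 1|) ∂μ =
      ∫ ω, ((ξ 1 1 ω : ℝ) - 1) ^ 2 * min 1 (r * |(ξ 1 1 ω : ℝ) - 1|) ∂μ :=
  ((h.centred_ident k n).comp (u := fun y => y ^ 2 * min 1 (r * |y|)) (by fun_prop)).integral_eq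

theorem centredSum_memLp [IsProbabilityMeasure μ]
     (h : IsCriticalGW μ ξ I c d) (n x : ℕ) :
    MemLp (centredSum ξ n x) 2 μ :=
  memLp_finsetSum _ fun k _ => h.centred_memLp k n

theorem integral_centredSum [IsProbabilityMeasure μ]
    (h : IsCriticalGW μ ξ I c d) (n x : ℕ) :
    ∫ ω, centredSum ξ n x ω ∂μ = 0 := by
  simp only [centredSum]
  rw [integral_finsetSum _ fun k _ => (h.centred_memLp k n).integrable one_le_two]
  simp [h.integral_centred]

theorem integral_centredSum_sq [IsProbabilityMeasure μ]
     (h : IsCriticalGW μ ξ I c d) (n x : ℕ) :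
    ∫ ω, centredSum ξ n x ω ^ 2 ∂μ = x * d := by
  simp only [centredSum]
  rw [integral_sum_sq_of_iIndepFun (h.centred_iIndepFun n) (fun k => h.centred_memLp k n)
    (fun k => h.integral_centred k n)]
  simp [h.integral_centred_sq]

theorem centredSum_indepFun_immigration (h : IsCriticalGW μ ξ I c d) (n x : ℕ) :
    IndepFun (centredSum ξ n x) (fun ω => (I n ω : ℝ)) μ := by
  have hd : Disjoint (Set.range (Sum.inl : ℕ × ℕ → (ℕ × ℕ) ⊕ ℕ)) (Set.range Sum.inr) := by
    rw [Set.disjoint_left]; rintro _ ⟨a, rfl⟩ ⟨b, hb⟩; cases hb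
  have h1 : Measurable[gwSigma ξ I (Set.range Sum.inl)] (centredSum ξ n x) := by
    let _ := gwSigma ξ I (Set.range Sum.inl)
    refine Finset.measurable_fun_sum _ fun k _ => ?_
    exact (measurable_from_top (f := fun m : ℕ => (m : ℝ) - 1)).comp
      (measurable_gwNoise_gwSigma ξ I (i := Sum.inl (k, n)) ⟨_, rfl⟩)
  have h2 : Measurable[gwSigma ξ I (Set.range Sum.inr)] (fun ω => (I n ω : ℝ)) := by
    let _ := gwSigma ξ I (Set.range Sum.inr)
    exact (measurable_from_top (f := fun m : ℕ => (m : ℝ))).comp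
      (measurable_gwNoise_gwSigma ξ I (i := Sum.inr n) ⟨_, rfl⟩)
  exact indep_of_indep_of_le_left (indep_of_indep_of_le_right (h.indep_gwSigma hd)
    h2.comap_le) h1.comap_le

theorem centredSum_add_memLp [IsProbabilityMeasure μ]
     (h : IsCriticalGW μ ξ I c d) (n x : ℕ) :
    MemLp (fun ω => centredSum ξ n x ω + I n ω) 2 μ :=
  (h.centredSum_memLp n x).add (h.immigration_memLp' n)

theorem integral_centredSum_add [IsProbabilityMeasure μ]
    (h : IsCriticalGW μ ξ I c d) (n x : ℕ) :
    ∫ ω, (centredSum ξ n x ω + I n ω) ∂μ = c := by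
  rw [integral_add ((h.centredSum_memLp n x).integrable one_le_two)
    ((h.immigration_memLp' n).integrable one_le_two), h.integral_centredSum,
    (h.immigration_ident' n).integral_eq, h.immigration_mean, zero_add]

theorem integral_immigration_sq (h : IsCriticalGW μ ξ I c d) (n : ℕ) :
    ∫ ω, (I n ω : ℝ) ^ 2 ∂μ = ∫ ω, (I 1 ω : ℝ) ^ 2 ∂μ :=
  ((h.immigration_ident' n).comp (u := fun y => y ^ 2) (by fun_prop)).integral_eq

theorem integral_centredSum_add_sq [IsProbabilityMeasure μ]
    (h : IsCriticalGW μ ξ I c d) (n x : ℕ) :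
    ∫ ω, (centredSum ξ n x ω + I n ω) ^ 2 ∂μ = x * d + ∫ ω, (I 1 ω : ℝ) ^ 2 ∂μ := by
  have h1 := h.centredSum_memLp n x
  have h2 := h.immigration_memLp' n
  have h3 : Integrable (fun ω => centredSum ξ n x ω * (I n ω : ℝ)) μ := h1.integrable_mul h2
  have h4 : ∫ ω, centredSum ξ n x ω * (I n ω : ℝ) ∂μ = 0 := by
    rw [(h.centredSum_indepFun_immigration n x).integral_fun_mul_eq_mul_integral h1.1 h2.1,
      h.integral_centredSum, zero_mul]
  have h5 : ∀ ω, (centredSum ξ n x ω + I n ω) ^ 2 = centredSum ξ n x ω ^ 2 +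
      2 * (centredSum ξ n x ω * (I n ω : ℝ)) + (I n ω : ℝ) ^ 2 := fun ω => by ring
  have h6 : Integrable (fun ω => centredSum ξ n x ω ^ 2 +
      2 * (centredSum ξ n x ω * (I n ω : ℝ))) μ := h1.integrable_sq.add (h3.const_mul 2)
  simp only [h5]
  rw [integral_add h6 h2.integrable_sq, integral_add h1.integrable_sq (h3.const_mul 2), integral_const_mul, h4,
    h.integral_centredSum_sq, h.integral_immigration_sq]
  ring

theorem integral_centredSum_add_sq_mul_min_le [IsProbabilityMeasure μ]
     (h : IsCriticalGW μ ξ I c d) (n x : ℕ) {r : ℝ}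
    (hr : 0 ≤ r) :
    ∫ ω, (centredSum ξ n x ω + I n ω) ^ 2 * min 1 (r * |centredSum ξ n x ω + I n ω|) ∂μ ≤
      8 * (x * (2 * r * d * √(x * d) +
        ∫ ω, ((ξ 1 1 ω : ℝ) - 1) ^ 2 * min 1 (r * |(ξ 1 1 ω : ℝ) - 1|) ∂μ)) +
      8 * ∫ ω, (I 1 ω : ℝ) ^ 2 ∂μ := by
  have h1 := integral_sum_sq_mul_min_le (h.centred_iIndepFun n)
    (fun k => h.centred_measurable k n) (fun k => h.centred_memLp k n)
    (fun k => h.integral_centred k n) (Finset.Icc 1 x) hr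
  simp only [h.integral_centred_sq, h.integral_centred_sq_mul_min, Finset.sum_const,
    Nat.card_Icc, add_tsub_cancel_right, nsmul_eq_mul] at h1
  have hS := integrable_sq_mul_min (h.centredSum_memLp n x) hr
  have hI := integrable_sq_mul_min (h.immigration_memLp' n) hr
  calc _ ≤ ∫ ω, (8 * (centredSum ξ n x ω ^ 2 * min 1 (r * |centredSum ξ n x ω|)) +
        8 * ((I n ω : ℝ) ^ 2 * min 1 (r * |(I n ω : ℝ)|))) ∂μ :=
        integral_mono (integrable_sq_mul_min (h.centredSum_add_memLp n x) hr)
          ((hS.const_mul 8).add (hI.const_mul 8)) fun ω => sq_mul_min_add_le hr _ _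
    _ = 8 * ∫ ω, (centredSum ξ n x ω ^ 2 * min 1 (r * |centredSum ξ n x ω|)) ∂μ +
        8 * ∫ ω, ((I n ω : ℝ) ^ 2 * min 1 (r * |(I n ω : ℝ)|)) ∂μ := by
        rw [integral_add (hS.const_mul 8) (hI.const_mul 8), integral_const_mul, integral_const_mul]
    _ ≤ _ := by
        refine add_le_add (mul_le_mul_of_nonneg_left h1 (by norm_num))
          (mul_le_mul_of_nonneg_left ?_ (by norm_num))
        rw [← h.integral_immigration_sq n]
        refine integral_mono hI (h.immigration_memLp' n).integrable_sq fun ω => ?_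
        exact mul_le_of_le_one_right (sq_nonneg _) (min_le_left _ _)

theorem integrable_gwStep [IsProbabilityMeasure μ]
    (h : IsCriticalGW μ ξ I c d) (n x : ℕ) :
    Integrable (fun ω => (gwStep ξ I n x ω : ℝ)) μ := by
  simp only [gwStep_eq_centredSum]
  exact (integrable_const _).add ((h.centredSum_add_memLp n x).integrable one_le_two)

theorem integral_gwStep [IsProbabilityMeasure μ]
    (h : IsCriticalGW μ ξ I c d) (n x : ℕ) :
    ∫ ω, (gwStep ξ I n x ω : ℝ) ∂μ = x + c := by
  simp only [gwStep_eq_centredSum]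
  rw [integral_add (integrable_const _) ((h.centredSum_add_memLp n x).integrable one_le_two),
    h.integral_centredSum_add]
  simp

theorem measurable_gwStep (h : IsCriticalGW μ ξ I c d) (n x : ℕ) : Measurable (gwStep ξ I n x) :=
  (measurable_gwStep_gwSigma ξ I n x).mono (h.gwSigma_le _) le_rfl

theorem integrable_gwStep_rpow [IsProbabilityMeasure μ]
     (h : IsCriticalGW μ ξ I c d) (n x : ℕ) {p : ℝ} (hp0 : 0 ≤ p)
    (hp1 : p ≤ 1) : Integrable (fun ω => (gwStep ξ I n x ω : ℝ) ^ p) μ := by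
  refine Integrable.mono ((integrable_const (1 : ℝ)).add (h.integrable_gwStep n x))
    ((measurable_from_top (f := fun m : ℕ => (m : ℝ) ^ p)).comp
      (h.measurable_gwStep n x)).aestronglyMeasurable (ae_of_all _ fun ω => ?_)
  have h0 : (0 : ℝ) ≤ gwStep ξ I n x ω := Nat.cast_nonneg _
  simp only [Pi.add_apply]
  rw [Real.norm_of_nonneg (by positivity), Real.norm_of_nonneg (by positivity)]
  rcases le_total (gwStep ξ I n x ω : ℝ) 1 with h1 | h1
  · linarith [Real.rpow_le_one h0 h1 hp0]
  · have := Real.rpow_le_rpow_of_exponent_le h1 hp1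
    rw [Real.rpow_one] at this
    linarith

open Filter Topology in
theorem tendsto_integral_sq_mul_min {Y : Ω → ℝ} (hY : MemLp Y 2 μ) :
    Tendsto (fun x : ℕ => ∫ ω, Y ω ^ 2 * min 1 (1 / (x : ℝ) * |Y ω|) ∂μ) atTop (𝓝 0) := by
  have h1 := tendsto_integral_of_dominated_convergence (μ := μ)
    (F := fun (x : ℕ) ω => Y ω ^ 2 * min 1 (1 / (x : ℝ) * |Y ω|)) (f := fun _ => (0 : ℝ))
    (fun ω => Y ω ^ 2) (fun x => (integrable_sq_mul_min hY (by positivity)).1) hY.integrable_sq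
    (fun x => ae_of_all _ fun ω => ?_) (ae_of_all _ fun ω => ?_)
  · simpa using h1
  · rw [Real.norm_of_nonneg (by positivity)]
    exact mul_le_of_le_one_right (sq_nonneg _) (min_le_left _ _)
  · have h2 : Tendsto (fun x : ℕ => 1 / (x : ℝ) * |Y ω|) atTop (𝓝 (0 * |Y ω|)) :=
      tendsto_one_div_atTop_nhds_zero_nat.mul_const _
    have h3 := (tendsto_const_nhds (x := Y ω ^ 2)).mul ((tendsto_const_nhds (x := (1 : ℝ))).min h2)
    simpa using h3

open Filter Topology in
/-- The expectation of a power of the size of the next generation, up to a lower order term. -/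
theorem exists_integral_gwStep_rpow_expansion [IsProbabilityMeasure μ]
     (h : IsCriticalGW μ ξ I c d) {p : ℝ} (hp0 : 0 < p)
    (hp1 : p < 1) :
    ∃ err : ℕ → ℝ, Tendsto err atTop (𝓝 0) ∧ ∀ n x : ℕ, 1 ≤ x →
      |∫ ω, (gwStep ξ I n x ω : ℝ) ^ p ∂μ -
        ((x : ℝ) ^ p + (x : ℝ) ^ (p - 1) * (p * c - p * (1 - p) / 2 * d))| ≤
        (x : ℝ) ^ (p - 1) * err x := by
  obtain ⟨C, hC0, hC⟩ := exists_rpow_one_add_expansion_bound hp0 hp1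
  set M := ∫ ω, (I 1 ω : ℝ) ^ 2 ∂μ with hM
  have hM0 : 0 ≤ M := integral_nonneg fun ω => sq_nonneg _
  let e : ℕ → ℝ := fun x =>
    ∫ ω, ((ξ 1 1 ω : ℝ) - 1) ^ 2 * min 1 (1 / (x : ℝ) * |(ξ 1 1 ω : ℝ) - 1|) ∂μ
  have he : Tendsto e atTop (𝓝 0) := tendsto_integral_sq_mul_min (h.centred_memLp 1 1)
  -- The first term comes from the constant part M in E[Δ²] = xd + M, the rest from the Taylor
  -- remainder with r = 1/x. The truncated moment `e x` vanishes by dominated convergence.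
  refine ⟨fun x => M * (1 / x) + C * (8 * (2 * d * √(d * (1 / x)) + e x) + 8 * M * (1 / x)),
    ?_, fun n x hx => ?_⟩
  · have h1 : Tendsto (fun x : ℕ => 1 / (x : ℝ)) atTop (𝓝 0) := tendsto_one_div_atTop_nhds_zero_nat
    have h2 := (h1.const_mul d).sqrt
    have h3 := (h1.const_mul M).add
      (((((h2.const_mul (2 * d)).add he).const_mul 8).add (h1.const_mul (8 * M))).const_mul C)
    simpa using h3
  · have hx0 : (0 : ℝ) < x := by exact_mod_cast hx
    let Δ : Ω → ℝ := fun ω => centredSum ξ n x ω + I n ω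
    have hΔ : MemLp Δ 2 μ := h.centredSum_add_memLp n x
    have hk := integrable_sq_mul_min hΔ (r := 1 / (x : ℝ)) (by positivity)
    have hpt : ∀ ω, |(gwStep ξ I n x ω : ℝ) ^ p - ((x : ℝ) ^ p +
        ((x : ℝ) ^ (p - 1) * p * Δ ω - (x : ℝ) ^ (p - 2) * (p * (1 - p) / 2) * Δ ω ^ 2))| ≤
        C * (x : ℝ) ^ (p - 2) * (Δ ω ^ 2 * min 1 (1 / (x : ℝ) * |Δ ω|)) := by
      intro ω
      have e0 : (gwStep ξ I n x ω : ℝ) = x + Δ ω := gwStep_eq_centredSum n x ω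
      have hu : -1 ≤ Δ ω / x := by
        rw [le_div_iff₀ hx0]
        have : (0 : ℝ) ≤ gwStep ξ I n x ω := Nat.cast_nonneg _
        linarith
      have h1 := mul_le_mul_of_nonneg_left (hC _ hu) (Real.rpow_nonneg hx0.le p)
      -- The expansion is applied to the relative increment u = Δ/x, which is at least -1 because
      -- the next generation has nonnegative size.
      have e1 : (gwStep ξ I n x ω : ℝ) ^ p = (x : ℝ) ^ p * (1 + Δ ω / x) ^ p := by
        rw [← Real.mul_rpow hx0.le (by linarith), e0]
        congr 1; field_simp
      have e2 : (x : ℝ) ^ (p - 1) = (x : ℝ) ^ p / x := Real.rpow_sub_one hx0.ne' p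
      have e3 : (x : ℝ) ^ (p - 2) = (x : ℝ) ^ p / x ^ 2 := by
        rw [Real.rpow_sub hx0, Real.rpow_two]
      have e4 : |Δ ω / x| = 1 / (x : ℝ) * |Δ ω| := by
        rw [abs_div, abs_of_pos hx0]; ring
      rw [e4] at h1
      calc _ = |(x : ℝ) ^ p * ((1 + Δ ω / x) ^ p -
            (1 + p * (Δ ω / x) + p * (p - 1) / 2 * (Δ ω / x) ^ 2))| := by
            rw [e1, e2, e3]; congr 1; field_simp; ring
        _ = (x : ℝ) ^ p * |(1 + Δ ω / x) ^ p -
            (1 + p * (Δ ω / x) + p * (p - 1) / 2 * (Δ ω / x) ^ 2)| := by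
            rw [abs_mul, abs_of_nonneg (Real.rpow_nonneg hx0.le p)]
        _ ≤ _ := h1
        _ = _ := by rw [e3]; field_simp
    have hi0 := h.integrable_gwStep_rpow n x hp0.le hp1.le
    have hi1 : Integrable (fun ω => (x : ℝ) ^ (p - 1) * p * Δ ω) μ :=
      (hΔ.integrable one_le_two).const_mul _
    have hi2 : Integrable (fun ω => (x : ℝ) ^ (p - 2) * (p * (1 - p) / 2) * Δ ω ^ 2) μ :=
      hΔ.integrable_sq.const_mul _
    have hi3 := (integrable_const ((x : ℝ) ^ p) (μ := μ)).add (hi1.sub hi2)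
    have hmean : ∫ ω, Δ ω ∂μ = c := h.integral_centredSum_add n x
    have hsq : ∫ ω, Δ ω ^ 2 ∂μ = x * d + M := h.integral_centredSum_add_sq n x
    have hint := (abs_integral_le_integral_abs (μ := μ)).trans
      (integral_mono (hi0.sub hi3).abs (hk.const_mul _) hpt)
    rw [integral_sub' hi0 hi3, integral_add' (integrable_const _) (hi1.sub hi2),
      integral_sub' hi1 hi2, integral_const_mul, integral_const_mul, integral_const_mul, hmean,
      hsq, integral_const, probReal_univ, one_smul] at hint
    have hkb := h.integral_centredSum_add_sq_mul_min_le n x (r := 1 / (x : ℝ)) (by positivity)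
    have e2 : (x : ℝ) ^ (p - 2) = (x : ℝ) ^ (p - 1) * (1 / x) := by
      rw [show p - 2 = p - 1 - 1 by ring, Real.rpow_sub_one hx0.ne' (p - 1)]; ring
    have e5 : √(d * (1 / x)) = 1 / x * √(x * d) := by
      rw [show d * (1 / (x : ℝ)) = (1 / x) ^ 2 * (x * d) by field_simp,
        Real.sqrt_mul (by positivity), Real.sqrt_sq (by positivity)]
    set P := (x : ℝ) ^ (p - 1)
    have hP : 0 ≤ P := Real.rpow_nonneg hx0.le _
    have h6 : C * (x : ℝ) ^ (p - 2) * ∫ ω, Δ ω ^ 2 * min 1 (1 / (x : ℝ) * |Δ ω|) ∂μ ≤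
        P * (C * (8 * (2 * d * √(d * (1 / x)) + e x) + 8 * M * (1 / x))) := by
      calc _ ≤ C * (x : ℝ) ^ (p - 2) * (8 * (x * (2 * (1 / x) * d * √(x * d) + e x)) + 8 * M) :=
            mul_le_mul_of_nonneg_left hkb (by positivity)
        _ = _ := by rw [e2, e5]; field_simp
    have h7 : |P * (p * (1 - p) / 2) * (M * (1 / x))| ≤ P * (M * (1 / x)) := by
      rw [abs_of_nonneg (by have : 0 ≤ 1 - p := by linarith
                            positivity)]
      have : P * (p * (1 - p) / 2) ≤ P := mul_le_of_le_one_right hP (by nlinarith)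
      gcongr
    -- The part of the quadratic term due to M has order x^(p-2) and is moved into the error.
    have h8 : ∀ a b m : ℝ, a - (b + (P * p * c - (x : ℝ) ^ (p - 2) * (p * (1 - p) / 2) *
        (x * d + m))) - P * (p * (1 - p) / 2) * (m * (1 / x)) =
        a - (b + P * (p * c - p * (1 - p) / 2 * d)) := by
      intro a b m; rw [e2]; field_simp; ring
    rw [← h8 _ _ M]
    refine (abs_sub _ _).trans ((add_le_add hint h7).trans ?_)
    beta_reduce
    rw [mul_add P]
    linarith

end IsCriticalGW

/-! ### Survival events and the Markov property. -/

/-- The event that the process has stayed above `A` up to time `n`. -/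
def gwSurvival {Ω : Type*} (ξ : ℕ → ℕ → Ω → ℕ) (I : ℕ → Ω → ℕ) (x₀ : ℕ) (A : ℝ) (n : ℕ) : Set Ω :=
  {ω | ∀ j ≤ n, A < (gwImmigration ξ I x₀ j ω : ℝ)}

section

variable {Ω : Type*} (ξ : ℕ → ℕ → Ω → ℕ) (I : ℕ → Ω → ℕ) (x₀ : ℕ) (A : ℝ)

theorem lt_hitBelow_iff (n : ℕ) (ω : Ω) :
    ((n : ℕ) : WithTop ℕ) < hitBelow (gwImmigration ξ I x₀) A ω ↔
      ω ∈ gwSurvival ξ I x₀ A n := by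
  have h := hittingAfter_le_iff (u := gwImmigration ξ I x₀) (s := {m : ℕ | (m : ℝ) ≤ A}) (n := 0)
    (i := n) (ω := ω)
  refine (not_le.symm.trans (not_congr h)).trans ?_
  simp [gwSurvival]

theorem gwSurvival_succ (n : ℕ) :
    gwSurvival ξ I x₀ A (n + 1) =
      gwSurvival ξ I x₀ A n ∩ {ω | A < (gwImmigration ξ I x₀ (n + 1) ω : ℝ)} := by
  ext ω
  simp only [gwSurvival, Set.mem_ofPred_eq, Set.mem_inter_iff, Nat.le_succ_iff]
  grind

theorem gwSurvival_antitone : Antitone (gwSurvival ξ I x₀ A) :=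
  fun _ _ hnm _ hω j hj => hω j (hj.trans hnm)

theorem gwSurvival_zero {A : ℝ} (hx : A < x₀) : gwSurvival ξ I x₀ A 0 = Set.univ := by
  ext ω; simpa [gwSurvival, gwImmigration] using hx

theorem measurableSet_gwSurvival_gwSigma (n : ℕ) :
    MeasurableSet[gwSigma ξ I (gwPast n)] (gwSurvival ξ I x₀ A n) := by
  let _ := gwSigma ξ I (gwPast n)
  have : gwSurvival ξ I x₀ A n =
      ⋂ j ∈ Finset.range (n + 1), gwImmigration ξ I x₀ j ⁻¹' {m | A < (m : ℝ)} := by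
    ext; simp [gwSurvival]
  rw [this]
  refine Finset.measurableSet_biInter _ fun j hj => ?_
  exact ((measurable_gwImmigration_gwSigma ξ I x₀ j).mono (gwSigma_mono ξ I fun i hi =>
    lt_of_lt_of_le hi (Nat.lt_succ_iff.1 (Finset.mem_range.1 hj))) le_rfl) (MeasurableSet.of_discrete)

end

namespace IsCriticalGW

variable {Ω : Type*} [MeasurableSpace Ω] {μ : Measure Ω}
  {ξ : ℕ → ℕ → Ω → ℕ} {I : ℕ → Ω → ℕ} {c d : ℝ}

theorem measurable_gwImmigration (h : IsCriticalGW μ ξ I c d) (x₀ n : ℕ) :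
    Measurable (gwImmigration ξ I x₀ n) :=
  (measurable_gwImmigration_gwSigma ξ I x₀ n).mono (h.gwSigma_le _) le_rfl

theorem measurableSet_gwSurvival (h : IsCriticalGW μ ξ I c d) (x₀ : ℕ) (A : ℝ) (n : ℕ) :
    MeasurableSet (gwSurvival ξ I x₀ A n) :=
  h.gwSigma_le _ _ (measurableSet_gwSurvival_gwSigma ξ I x₀ A n)

theorem setLIntegral_gwStep (h : IsCriticalGW μ ξ I c d) (n x : ℕ) {E : Set Ω}
    (hE : MeasurableSet[gwSigma ξ I (gwPast n)] E) (f : ℕ → ENNReal) :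
    ∫⁻ ω in E, f (gwStep ξ I n x ω) ∂μ = μ E * ∫⁻ ω, f (gwStep ξ I n x ω) ∂μ := by
  have hE' := h.gwSigma_le _ _ hE
  have hd : Disjoint (gwPast n) (gwPresent n) :=
    Set.disjoint_left.2 fun i hi hi' => (ne_of_lt hi) hi'
  have h1 := lintegral_mul_eq_lintegral_mul_lintegral_of_independent_measurableSpace
    (h.gwSigma_le (gwPast n)) (h.gwSigma_le (gwPresent n)) (h.indep_gwSigma hd)
    (f := E.indicator fun _ => 1) (g := fun ω => f (gwStep ξ I n x ω))
    ((@measurable_const _ _ _ (_) _).indicator hE)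
    ((Measurable.of_discrete (f := f)).comp (measurable_gwStep_gwSigma ξ I n x))
  rw [lintegral_indicator_const hE', one_mul] at h1
  rw [← h1, ← lintegral_indicator hE']
  congr 1; ext ω
  by_cases hω : ω ∈ E <;> simp [hω]

/-- The Markov property. -/
theorem setLIntegral_gwImmigration_succ (h : IsCriticalGW μ ξ I c d) (x₀ n : ℕ) {E : Set Ω}
    (hE : MeasurableSet[gwSigma ξ I (gwPast n)] E) (f : ℕ → ENNReal) :
    ∫⁻ ω in E, f (gwImmigration ξ I x₀ (n + 1) ω) ∂μ =
      ∫⁻ ω in E, (∫⁻ ω', f (gwStep ξ I n (gwImmigration ξ I x₀ n ω) ω') ∂μ) ∂μ := by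
  set X := gwImmigration ξ I x₀ n
  have hEX : ∀ x, MeasurableSet[gwSigma ξ I (gwPast n)] (E ∩ X ⁻¹' {x}) := fun x =>
    hE.inter (measurable_gwImmigration_gwSigma ξ I x₀ n (MeasurableSet.of_discrete))
  -- Splitting over the countably many values of X_n freezes the state, so independence of past and
  -- present noise replaces conditional expectations.
  have hsplit : ∀ g : Ω → ENNReal,
      ∫⁻ ω in E, g ω ∂μ = ∑' x, ∫⁻ ω in E ∩ X ⁻¹' {x}, g ω ∂μ := by
    intro g
    rw [← lintegral_iUnion (fun x => h.gwSigma_le _ _ (hEX x))]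
    · congr 2; ext ω; simp
    · intro a b hab
      refine Set.disjoint_left.2 fun ω ha hb => hab ?_
      rw [← ha.2, ← hb.2]
  rw [hsplit, hsplit]
  congr 1; ext x
  have h1 : ∫⁻ ω in E ∩ X ⁻¹' {x}, f (gwImmigration ξ I x₀ (n + 1) ω) ∂μ =
      ∫⁻ ω in E ∩ X ⁻¹' {x}, f (gwStep ξ I n x ω) ∂μ := by
    refine setLIntegral_congr_fun (h.gwSigma_le _ _ (hEX x)) fun ω hω => ?_
    have : X ω = x := hω.2
    change f (gwStep ξ I n (X ω) ω) = _
    rw [this]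
  have h2 : ∫⁻ ω in E ∩ X ⁻¹' {x}, (∫⁻ ω', f (gwStep ξ I n (X ω) ω') ∂μ) ∂μ =
      ∫⁻ _ in E ∩ X ⁻¹' {x}, (∫⁻ ω', f (gwStep ξ I n x ω') ∂μ) ∂μ := by
    refine setLIntegral_congr_fun (h.gwSigma_le _ _ (hEX x)) fun ω hω => ?_
    have : X ω = x := hω.2
    simp only [this]
  rw [h1, h2, h.setLIntegral_gwStep n x (hEX x), setLIntegral_const, mul_comm]

end IsCriticalGW

/-! ### Drift of powers and the upper bound on cumulative survival. -/

namespace IsCriticalGW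

variable {Ω : Type*} [MeasurableSpace Ω] {μ : Measure Ω} [IsProbabilityMeasure μ]
  {ξ : ℕ → ℕ → Ω → ℕ} {I : ℕ → Ω → ℕ} {c d : ℝ}

-- The leading coefficient pc - p(1-p)d/2 equals (pd/2)(p - (1 - 2c/d)). Half of its absolute value
-- absorbs the error and the other half is `κ`.
open Filter Topology in
theorem exists_rpow_drift_neg (h : IsCriticalGW μ ξ I c d) (hd : 0 < d) {p : ℝ} (hp0 : 0 < p)
    (hp1 : p < 1) (hp : p < 1 - 2 * c / d) :
    ∃ N : ℕ, ∃ κ : ℝ, 0 < κ ∧ ∀ n x : ℕ, 1 ≤ x → N ≤ x →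
      ∫ ω, (gwStep ξ I n x ω : ℝ) ^ p ∂μ + κ * (x : ℝ) ^ (p - 1) ≤ (x : ℝ) ^ p := by
  obtain ⟨err, herr, hbound⟩ := h.exists_integral_gwStep_rpow_expansion hp0 hp1
  have hκ : 0 < -(p * c - p * (1 - p) / 2 * d) := by
    have h1 : 2 * c / d * d = 2 * c := div_mul_cancel₀ _ hd.ne'
    have h2 : 2 * c < (1 - p) * d := by nlinarith
    nlinarith
  obtain ⟨N, hN⟩ := eventually_atTop.1 (herr.eventually_lt_const (half_pos hκ))
  refine ⟨N, _, half_pos hκ, fun n x hx hNx => ?_⟩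
  have h1 := (abs_le.1 (hbound n x hx)).2
  have h2 : 0 ≤ (x : ℝ) ^ (p - 1) := by positivity
  nlinarith [hN x hNx]

open Filter Topology in
theorem exists_rpow_drift_pos (h : IsCriticalGW μ ξ I c d) (hd : 0 < d) {p : ℝ} (hp0 : 0 < p)
    (hp1 : p < 1) (hp : 1 - 2 * c / d < p) :
    ∃ N : ℕ, ∀ n x : ℕ, 1 ≤ x → N ≤ x →
      (x : ℝ) ^ p ≤ ∫ ω, (gwStep ξ I n x ω : ℝ) ^ p ∂μ := by
  obtain ⟨err, herr, hbound⟩ := h.exists_integral_gwStep_rpow_expansion hp0 hp1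
  have hκ : 0 < p * c - p * (1 - p) / 2 * d := by
    have h1 : 2 * c / d * d = 2 * c := div_mul_cancel₀ _ hd.ne'
    have h2 : (1 - p) * d < 2 * c := by nlinarith
    nlinarith
  obtain ⟨N, hN⟩ := eventually_atTop.1 (herr.eventually_lt_const hκ)
  refine ⟨N, fun n x hx hNx => ?_⟩
  have h1 := (abs_le.1 (hbound n x hx)).1
  have h2 : 0 ≤ (x : ℝ) ^ (p - 1) := by positivity
  nlinarith [hN x hNx]

theorem exists_rpow_drift_le (h : IsCriticalGW μ ξ I c d) {p : ℝ} (hp0 : 0 < p) (hp1 : p < 1) :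
    ∃ M : ℝ, 0 ≤ M ∧ ∀ n x : ℕ, 1 ≤ x →
      ∫ ω, (gwStep ξ I n x ω : ℝ) ^ p ∂μ ≤ (x : ℝ) ^ p + M * (x : ℝ) ^ (p - 1) := by
  obtain ⟨err, herr, hbound⟩ := h.exists_integral_gwStep_rpow_expansion hp0 hp1
  obtain ⟨K, hK⟩ := herr.bddAbove_range
  refine ⟨|p * c - p * (1 - p) / 2 * d| + |K|, by positivity, fun n x hx => ?_⟩
  have h1 := (abs_le.1 (hbound n x hx)).2
  have h2 : 0 ≤ (x : ℝ) ^ (p - 1) := by positivity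
  have h3 : err x ≤ |K| := (hK ⟨x, rfl⟩).trans (le_abs_self K)
  have h4 := le_abs_self (p * c - p * (1 - p) / 2 * d)
  nlinarith

/-- A Lyapunov function with the growth of `x ^ p` whose drift is negative above a level that works
for a smaller power `p₀` and does not depend on `p`. -/
theorem exists_lyapunov (h : IsCriticalGW μ ξ I c d) (hd : 0 < d) {p₀ p κ₀ : ℝ} {N₀ : ℕ}
    (hp₀ : 0 < p₀) (hpp : p₀ ≤ p) (hp1 : p < 1) (hp : p < 1 - 2 * c / d) (hκ₀ : 0 < κ₀)
    (h₀ : ∀ n x : ℕ, 1 ≤ x → N₀ ≤ x →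
      ∫ ω, (gwStep ξ I n x ω : ℝ) ^ p₀ ∂μ + κ₀ * (x : ℝ) ^ (p₀ - 1) ≤ (x : ℝ) ^ p₀) :
    ∃ K κ : ℝ, 0 ≤ K ∧ 0 < κ ∧ ∀ n x : ℕ, 1 ≤ x → N₀ ≤ x →
      ∫ ω, ((gwStep ξ I n x ω : ℝ) ^ p + K * (gwStep ξ I n x ω : ℝ) ^ p₀) ∂μ +
        κ * (x : ℝ) ^ (p - 1) ≤ (x : ℝ) ^ p + K * (x : ℝ) ^ p₀ := by
  have hp0 : 0 < p := hp₀.trans_le hpp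
  obtain ⟨N, κ, hκ, hN⟩ := h.exists_rpow_drift_neg hd hp0 hp1 hp
  obtain ⟨M, hM, hbound⟩ := h.exists_rpow_drift_le hp0 hp1
  have hK : 0 ≤ (M + 1) / κ₀ * (N : ℝ) ^ (p - p₀) := by positivity
  -- Beyond N, x^p has its own negative drift. Between N₀ and N its drift is at most M x^(p-1), and
  -- K is chosen so that K κ₀ x^(p₀-1) ≥ (M + 1) x^(p-1) there, since x^(p-p₀) ≤ N^(p-p₀).
  refine ⟨(M + 1) / κ₀ * (N : ℝ) ^ (p - p₀), min κ 1, hK, lt_min hκ one_pos,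
    fun n x hx hNx => ?_⟩
  have hx0 : (0 : ℝ) < x := by exact_mod_cast hx
  have h1 := mul_le_mul_of_nonneg_left (h₀ n x hx hNx) hK
  have h2 : 0 ≤ (x : ℝ) ^ (p - 1) := by positivity
  rw [integral_add (h.integrable_gwStep_rpow n x hp0.le hp1.le)
    ((h.integrable_gwStep_rpow n x hp₀.le (hpp.trans hp1.le)).const_mul _), integral_const_mul]
  rcases le_total N x with hx' | hx'
  · have h3 := hN n x hx hx'
    have h4 : 0 ≤ (M + 1) / κ₀ * (N : ℝ) ^ (p - p₀) * (κ₀ * (x : ℝ) ^ (p₀ - 1)) := by positivity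
    have h5 : min κ 1 * (x : ℝ) ^ (p - 1) ≤ κ * (x : ℝ) ^ (p - 1) := by
      gcongr; exact min_le_left _ _
    linarith
  · have h3 := hbound n x hx
    have h4 : (M + 1) * (x : ℝ) ^ (p - 1) ≤
        (M + 1) / κ₀ * (N : ℝ) ^ (p - p₀) * (κ₀ * (x : ℝ) ^ (p₀ - 1)) := by
      calc (M + 1) * (x : ℝ) ^ (p - 1) = (M + 1) * ((x : ℝ) ^ (p - p₀) * (x : ℝ) ^ (p₀ - 1)) := by
            rw [← Real.rpow_add hx0]; ring_nf
        _ ≤ (M + 1) * ((N : ℝ) ^ (p - p₀) * (x : ℝ) ^ (p₀ - 1)) := by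
            gcongr
        _ = _ := by field_simp
    have h5 : min κ 1 * (x : ℝ) ^ (p - 1) ≤ 1 * (x : ℝ) ^ (p - 1) := by
      gcongr; exact min_le_right _ _
    linarith

-- One step of Dynkin's formula for the killed process: as W is nonnegative, killing only loses
-- mass.
omit [IsProbabilityMeasure μ] in
theorem setLIntegral_drift_le (h : IsCriticalGW μ ξ I c d) (x₀ : ℕ) {A : ℝ} {W V : ℕ → ENNReal}
    (n : ℕ) (hWV : ∀ x : ℕ, A < x → ∫⁻ ω, W (gwStep ξ I n x ω) ∂μ + V x ≤ W x) :
    ∫⁻ ω in gwSurvival ξ I x₀ A (n + 1), W (gwImmigration ξ I x₀ (n + 1) ω) ∂μ +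
      ∫⁻ ω in gwSurvival ξ I x₀ A n, V (gwImmigration ξ I x₀ n ω) ∂μ ≤
      ∫⁻ ω in gwSurvival ξ I x₀ A n, W (gwImmigration ξ I x₀ n ω) ∂μ := by
  calc _ ≤ ∫⁻ ω in gwSurvival ξ I x₀ A n, W (gwImmigration ξ I x₀ (n + 1) ω) ∂μ +
        ∫⁻ ω in gwSurvival ξ I x₀ A n, V (gwImmigration ξ I x₀ n ω) ∂μ :=
        add_le_add_left (lintegral_mono_set (gwSurvival_antitone ξ I x₀ A n.le_succ)) _
    _ = ∫⁻ ω in gwSurvival ξ I x₀ A n,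
          (∫⁻ ω', W (gwStep ξ I n (gwImmigration ξ I x₀ n ω) ω') ∂μ +
            V (gwImmigration ξ I x₀ n ω)) ∂μ := by
        rw [h.setLIntegral_gwImmigration_succ x₀ n (measurableSet_gwSurvival_gwSigma ξ I x₀ A n),
          lintegral_add_right]
        exact (Measurable.of_discrete (f := V)).comp (h.measurable_gwImmigration x₀ n)
    _ ≤ _ := setLIntegral_mono' (h.measurableSet_gwSurvival x₀ A n) fun ω hω =>
        hWV _ (hω n le_rfl)

/-- If `W` grows at least as `x ^ p` and its drift is at most `-κ x ^ (p - 1)` above `A`, then the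
expected time spent above `A` before hitting, truncated at `n`, is of order `n ^ (1 - p)`. -/
theorem sum_gwSurvival_le (h : IsCriticalGW μ ξ I c d) {x₀ : ℕ} {A : ℝ} (hA : 0 ≤ A)
    (hx₀ : A < x₀) {p κ : ℝ} (hp0 : 0 ≤ p) (hp1 : p ≤ 1) (hκ : 0 < κ) {W : ℕ → ℝ}
    (hW0 : ∀ x, 0 ≤ W x) (hWp : ∀ x : ℕ, (x : ℝ) ^ p ≤ W x)
    (hWi : ∀ n x, Integrable (fun ω => W (gwStep ξ I n x ω)) μ)
    (hdrift : ∀ n x : ℕ, A < x → ∫ ω, W (gwStep ξ I n x ω) ∂μ + κ * (x : ℝ) ^ (p - 1) ≤ W x)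
    {n : ℕ} (hn : 1 ≤ n) :
    ∑ k ∈ Finset.range n, μ.real (gwSurvival ξ I x₀ A k) ≤
      W x₀ * (1 / κ + 1) * (n : ℝ) ^ (1 - p) := by
  set B := gwSurvival ξ I x₀ A with hB
  set X := gwImmigration ξ I x₀ with hX
  let V : ℕ → ℝ := fun x => κ * (x : ℝ) ^ (p - 1)
  let u : ℕ → ENNReal := fun k => ∫⁻ ω in B k, ENNReal.ofReal (W (X k ω)) ∂μ
  let v : ℕ → ENNReal := fun k => ∫⁻ ω in B k, ENNReal.ofReal (V (X k ω)) ∂μ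
  have hn0 : (0 : ℝ) < n := by exact_mod_cast hn
  have hV0 : ∀ x, 0 ≤ V x := fun x => by positivity
  have hstep : ∀ k, u (k + 1) + v k ≤ u k := fun k => by
    refine h.setLIntegral_drift_le x₀ (W := fun x => ENNReal.ofReal (W x))
      (V := fun x => ENNReal.ofReal (V x)) k fun x hx => ?_
    rw [← ofReal_integral_eq_lintegral_ofReal (hWi k x) (ae_of_all _ fun ω => hW0 _),
      ← ENNReal.ofReal_add (integral_nonneg fun ω => hW0 _) (hV0 x)]
    exact ENNReal.ofReal_le_ofReal (hdrift k x hx)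
  have hu0 : u 0 = ENNReal.ofReal (W x₀) := by
    simp only [u, hB, gwSurvival_zero ξ I x₀ hx₀, hX, gwImmigration]
    simp
  have hsum : ∀ N, u N + ∑ k ∈ Finset.range N, v k ≤ ENNReal.ofReal (W x₀) := by
    intro N
    induction N with
    | zero => simp [hu0]
    | succ N ih =>
      rw [Finset.sum_range_succ]
      calc _ = (u (N + 1) + v N) + ∑ k ∈ Finset.range N, v k := by ring
        _ ≤ u N + ∑ k ∈ Finset.range N, v k := by gcongr; exact hstep N
        _ ≤ _ := ih
  -- The truncation level is n: for x ≤ n the first term is at least (n/x)^(1-p) ≥ 1, and for x ≥ n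
  -- the second is at least (x/n)^p ≥ 1.
  have hpt : ∀ x : ℕ, A < x →
      1 ≤ ENNReal.ofReal ((n : ℝ) ^ (1 - p) / κ) * ENNReal.ofReal (V x) +
        ENNReal.ofReal ((n : ℝ) ^ (-p)) * ENNReal.ofReal (W x) := by
    intro x hx
    have hx0 : (0 : ℝ) < x := hA.trans_lt hx
    have h1 : 0 ≤ (n : ℝ) ^ (1 - p) / κ * V x := mul_nonneg (by positivity) (hV0 x)
    have h2 : 0 ≤ (n : ℝ) ^ (-p) * W x := mul_nonneg (by positivity) (hW0 x)
    rw [← ENNReal.ofReal_mul (by positivity), ← ENNReal.ofReal_mul (by positivity),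
      ← ENNReal.ofReal_add h1 h2, ← ENNReal.ofReal_one]
    refine ENNReal.ofReal_le_ofReal ?_
    rcases le_total (x : ℝ) n with hxn | hxn
    · have h3 : (n : ℝ) ^ (1 - p) / κ * V x = ((n : ℝ) / x) ^ (1 - p) := by
        simp only [V]
        rw [Real.div_rpow hn0.le hx0.le, show p - 1 = -(1 - p) by ring, Real.rpow_neg hx0.le]
        field_simp
      have h4 : 1 ≤ ((n : ℝ) / x) ^ (1 - p) :=
        Real.one_le_rpow ((one_le_div hx0).2 hxn) (by linarith)
      linarith
    · have h3 : 1 ≤ ((x : ℝ) / n) ^ p := Real.one_le_rpow ((one_le_div hn0).2 hxn) hp0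
      have h4 : ((x : ℝ) / n) ^ p = (n : ℝ) ^ (-p) * (x : ℝ) ^ p := by
        rw [Real.div_rpow hx0.le hn0.le, Real.rpow_neg hn0.le]; ring
      have h5 : (n : ℝ) ^ (-p) * (x : ℝ) ^ p ≤ (n : ℝ) ^ (-p) * W x := by
        gcongr; exact hWp x
      linarith
  have hμ : ∀ k, μ (B k) ≤ ENNReal.ofReal ((n : ℝ) ^ (1 - p) / κ) * v k +
      ENNReal.ofReal ((n : ℝ) ^ (-p)) * ENNReal.ofReal (W x₀) := by
    intro k
    have hmV : Measurable fun ω => ENNReal.ofReal (V (X k ω)) :=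
      (Measurable.of_discrete (f := fun x => ENNReal.ofReal (V x))).comp
        (h.measurable_gwImmigration x₀ k)
    have hmW : Measurable fun ω => ENNReal.ofReal (W (X k ω)) :=
      (Measurable.of_discrete (f := fun x => ENNReal.ofReal (W x))).comp
        (h.measurable_gwImmigration x₀ k)
    calc μ (B k) = ∫⁻ _ in B k, 1 ∂μ := by simp
      _ ≤ ∫⁻ ω in B k, (ENNReal.ofReal ((n : ℝ) ^ (1 - p) / κ) * ENNReal.ofReal (V (X k ω)) +
            ENNReal.ofReal ((n : ℝ) ^ (-p)) * ENNReal.ofReal (W (X k ω))) ∂μ :=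
          setLIntegral_mono' (h.measurableSet_gwSurvival x₀ A k) fun ω hω => hpt _ (hω k le_rfl)
      _ = ENNReal.ofReal ((n : ℝ) ^ (1 - p) / κ) * v k + ENNReal.ofReal ((n : ℝ) ^ (-p)) * u k := by
          rw [lintegral_add_left (hmV.const_mul _), lintegral_const_mul _ hmV,
            lintegral_const_mul _ hmW]
      _ ≤ _ := by gcongr; exact le_self_add.trans (hsum k)
  have htot : ∑ k ∈ Finset.range n, μ (B k) ≤
      ENNReal.ofReal (W x₀ * (1 / κ + 1) * (n : ℝ) ^ (1 - p)) := by
    calc _ ≤ ∑ k ∈ Finset.range n, (ENNReal.ofReal ((n : ℝ) ^ (1 - p) / κ) * v k +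
          ENNReal.ofReal ((n : ℝ) ^ (-p)) * ENNReal.ofReal (W x₀)) :=
          Finset.sum_le_sum fun k _ => hμ k
      _ = ENNReal.ofReal ((n : ℝ) ^ (1 - p) / κ) * ∑ k ∈ Finset.range n, v k +
          n * (ENNReal.ofReal ((n : ℝ) ^ (-p)) * ENNReal.ofReal (W x₀)) := by
          rw [Finset.sum_add_distrib, Finset.mul_sum]; simp
      _ ≤ ENNReal.ofReal ((n : ℝ) ^ (1 - p) / κ) * ENNReal.ofReal (W x₀) +
          n * (ENNReal.ofReal ((n : ℝ) ^ (-p)) * ENNReal.ofReal (W x₀)) := by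
          gcongr; exact le_add_self.trans (hsum n)
      _ = _ := by
          have := hW0 x₀
          rw [← ENNReal.ofReal_natCast, ← ENNReal.ofReal_mul (by positivity),
            ← ENNReal.ofReal_mul (by positivity), ← ENNReal.ofReal_mul (by positivity),
            ← ENNReal.ofReal_add (by positivity) (by positivity)]
          congr 1
          rw [sub_eq_add_neg, Real.rpow_add hn0, Real.rpow_one]; ring
  simp only [Measure.real]
  rw [← ENNReal.toReal_sum fun k _ => measure_ne_top μ _]
  exact ENNReal.toReal_le_of_le_ofReal
    (mul_nonneg (mul_nonneg (hW0 _) (by positivity)) (by positivity)) htot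

/-- Offspring preserve the mean, so each generation adds only c P(τ > k), and killing can only
decrease the expectation. -/
theorem setLIntegral_gwImmigration_le (h : IsCriticalGW μ ξ I c d) (hc : 0 ≤ c) {x₀ : ℕ} {A : ℝ}
    (hx₀ : A < x₀) (n : ℕ) :
    ∫⁻ ω in gwSurvival ξ I x₀ A n, (gwImmigration ξ I x₀ n ω : ENNReal) ∂μ ≤
      ENNReal.ofReal (x₀ + c * ∑ k ∈ Finset.range n, μ.real (gwSurvival ξ I x₀ A k)) := by
  induction n with
  | zero => simp [gwSurvival_zero ξ I x₀ hx₀, gwImmigration]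
  | succ n ih =>
    have hΦ : ∀ x : ℕ, ∫⁻ ω, (gwStep ξ I n x ω : ENNReal) ∂μ = x + ENNReal.ofReal c := fun x => by
      rw [← ENNReal.ofReal_natCast x, ← ENNReal.ofReal_add (by positivity) hc,
        ← h.integral_gwStep n x, ofReal_integral_eq_lintegral_ofReal (h.integrable_gwStep n x)
          (ae_of_all _ fun ω => Nat.cast_nonneg _)]
      simp
    calc _ ≤ ∫⁻ ω in gwSurvival ξ I x₀ A n, (gwImmigration ξ I x₀ (n + 1) ω : ENNReal) ∂μ :=
          lintegral_mono_set (gwSurvival_antitone ξ I x₀ A n.le_succ)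
      _ = ∫⁻ ω in gwSurvival ξ I x₀ A n,
            ((gwImmigration ξ I x₀ n ω : ENNReal) + ENNReal.ofReal c) ∂μ := by
          rw [h.setLIntegral_gwImmigration_succ x₀ n
            (measurableSet_gwSurvival_gwSigma ξ I x₀ A n) (fun m => (m : ENNReal))]
          simp only [hΦ]
      _ = ∫⁻ ω in gwSurvival ξ I x₀ A n, (gwImmigration ξ I x₀ n ω : ENNReal) ∂μ +
            ENNReal.ofReal c * μ (gwSurvival ξ I x₀ A n) := by
          rw [lintegral_add_right _ measurable_const, setLIntegral_const]
      _ ≤ ENNReal.ofReal (x₀ + c * ∑ k ∈ Finset.range n, μ.real (gwSurvival ξ I x₀ A k)) +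
            ENNReal.ofReal (c * μ.real (gwSurvival ξ I x₀ A n)) := by
          rw [ENNReal.ofReal_mul hc, ofReal_measureReal]
          gcongr
      _ = _ := by
          rw [← ENNReal.ofReal_add (by positivity) (by positivity), Finset.sum_range_succ]
          ring_nf

end IsCriticalGW

theorem MeasureTheory.ofReal_integral_le_lintegral_ofReal {Ω : Type*} [MeasurableSpace Ω]
    {μ : Measure Ω} {f : Ω → ℝ} (hf : Integrable f μ) :
    ENNReal.ofReal (∫ ω, f ω ∂μ) ≤ ∫⁻ ω, ENNReal.ofReal (f ω) ∂μ := by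
  have h1 := ofReal_integral_eq_lintegral_ofReal hf.pos_part (ae_of_all _ fun ω => le_max_right _ _)
  simp only [ENNReal.ofReal_max, ENNReal.ofReal_zero, zero_le, max_eq_left] at h1
  rw [← h1]
  exact ENNReal.ofReal_le_ofReal (integral_mono hf hf.pos_part fun ω => le_max_left _ _)

/-! ### The lower bound on survival. -/

namespace IsCriticalGW

variable {Ω : Type*} [MeasurableSpace Ω] {μ : Measure Ω} [IsProbabilityMeasure μ]
  {ξ : ℕ → ℕ → Ω → ℕ} {I : ℕ → Ω → ℕ} {c d : ℝ}

/-- The mean x + c exceeds x, so the step cannot be almost surely at most x. -/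
theorem measure_lt_gwStep_pos (h : IsCriticalGW μ ξ I c d) (hc : 0 < c) (n x : ℕ) :
    0 < μ {ω | x < gwStep ξ I n x ω} := by
  refine pos_iff_ne_zero.2 fun h0 => ?_
  have h1 : ∀ᵐ ω ∂μ, (gwStep ξ I n x ω : ℝ) ≤ x := by
    rw [ae_iff]
    simpa using h0
  have h2 := integral_mono_ae (h.integrable_gwStep n x) (integrable_const (x : ℝ)) h1
  rw [h.integral_gwStep] at h2
  simp at h2
  linarith

theorem measure_gwSurvival_inter_pos (h : IsCriticalGW μ ξ I c d) (hc : 0 < c) {x₀ : ℕ} {A : ℝ}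
    (hx₀ : A < x₀) (m : ℕ) :
    0 < μ (gwSurvival ξ I x₀ A m ∩ {ω | x₀ + m ≤ gwImmigration ξ I x₀ m ω}) := by
  induction m with
  | zero => simp [gwSurvival_zero ξ I x₀ hx₀, gwImmigration]
  | succ m ih =>
    set E := gwSurvival ξ I x₀ A m ∩ {ω | x₀ + m ≤ gwImmigration ξ I x₀ m ω} with hE
    have hEm : MeasurableSet[gwSigma ξ I (gwPast m)] E :=
      (measurableSet_gwSurvival_gwSigma ξ I x₀ A m).inter
        (measurable_gwImmigration_gwSigma ξ I x₀ m (MeasurableSet.of_discrete (s := Set.Ici (x₀ + m))))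
    have hE' := h.gwSigma_le _ _ hEm
    let f : ℕ → ENNReal := (Set.Ici (x₀ + (m + 1))).indicator fun _ => 1
    have hΦ : ∀ x : ℕ, x₀ + m ≤ x → 0 < ∫⁻ ω, f (gwStep ξ I m x ω) ∂μ := by
      intro x hx
      refine (h.measure_lt_gwStep_pos hc m x).trans_le ?_
      have hms : MeasurableSet {ω | x < gwStep ξ I m x ω} :=
        h.measurable_gwStep m x (MeasurableSet.of_discrete (s := Set.Ioi x))
      rw [← lintegral_indicator_one hms]
      refine lintegral_mono fun ω => ?_
      by_cases hω : x < gwStep ξ I m x ω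
      · have : x₀ + (m + 1) ≤ gwStep ξ I m x ω := by omega
        simp [f, hω, this]
      · simp [hω]
    have hpos : 0 < ∫⁻ ω in E, f (gwImmigration ξ I x₀ (m + 1) ω) ∂μ := by
      rw [h.setLIntegral_gwImmigration_succ x₀ m hEm f, setLIntegral_pos_iff]
      · refine ih.trans_le (measure_mono fun ω hω => ⟨?_, hω⟩)
        exact (hΦ _ hω.2).ne'
      · exact (Measurable.of_discrete (f := fun x => ∫⁻ ω', f (gwStep ξ I m x ω') ∂μ)).comp
          (h.measurable_gwImmigration x₀ m)
    refine hpos.trans_le ?_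
    have hms : MeasurableSet {ω | x₀ + (m + 1) ≤ gwImmigration ξ I x₀ (m + 1) ω} :=
      h.measurable_gwImmigration x₀ (m + 1) (MeasurableSet.of_discrete (s := Set.Ici (x₀ + (m + 1))))
    have hfi : (fun ω => f (gwImmigration ξ I x₀ (m + 1) ω)) =
        {ω | x₀ + (m + 1) ≤ gwImmigration ξ I x₀ (m + 1) ω}.indicator fun _ => 1 := by
      ext ω; simp [f, Set.indicator]
    rw [hfi, setLIntegral_indicator hms, setLIntegral_one]
    refine measure_mono fun ω hω => ⟨?_, hω.1⟩
    rw [gwSurvival_succ]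
    refine ⟨hω.2.1, ?_⟩
    have h1 : x₀ + (m + 1) ≤ gwImmigration ξ I x₀ (m + 1) ω := hω.1
    have h2 : (x₀ : ℝ) ≤ gwImmigration ξ I x₀ (m + 1) ω := by exact_mod_cast (by omega)
    exact hx₀.trans_le h2

/-- A power with positive drift, killed below `A`, has expectation bounded away from zero. -/
theorem exists_le_setLIntegral_rpow (h : IsCriticalGW μ ξ I c d) (hc : 0 < c) {x₀ : ℕ} {A : ℝ}
    (hx₀ : A < x₀) {q : ℝ} (hq0 : 0 < q) (hq1 : q ≤ 1) {N : ℕ}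
    (hN : ∀ n x : ℕ, 1 ≤ x → N ≤ x → (x : ℝ) ^ q ≤ ∫ ω, (gwStep ξ I n x ω : ℝ) ^ q ∂μ) :
    ∃ g : ℝ, 0 < g ∧ ∃ m : ℕ, 1 ≤ m ∧ ∀ n, m ≤ n → ENNReal.ofReal g ≤
      ∫⁻ ω in gwSurvival ξ I x₀ A n,
        ENNReal.ofReal ((gwImmigration ξ I x₀ n ω : ℝ) ^ q) ∂μ := by
  obtain ⟨a, haN⟩ : ∃ a : ℕ, N ≤ a ∧ A ≤ a := by
    obtain ⟨b, hb⟩ := exists_nat_ge A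
    exact ⟨max N b, le_max_left _ _, hb.trans (by exact_mod_cast le_max_right _ _)⟩
  -- `ENNReal.ofReal` makes this the positive part. It is subharmonic everywhere and vanishes up to
  -- a ≥ A, so killing at A costs nothing, even when the threshold N for q lies above A.
  let H : ℕ → ENNReal := fun x => ENNReal.ofReal ((x : ℝ) ^ q - (a : ℝ) ^ q)
  have hH0 : ∀ x : ℕ, x ≤ a → H x = 0 := fun x hx =>
    ENNReal.ofReal_of_nonpos (sub_nonpos.2 (by gcongr))
  have hHpos : ∀ x : ℕ, a < x → 0 < H x := fun x hx =>
    ENNReal.ofReal_pos.2 (sub_pos.2 (by gcongr))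
  have hΦ : ∀ n x : ℕ, H x ≤ ∫⁻ ω, H (gwStep ξ I n x ω) ∂μ := by
    intro n x
    rcases le_or_gt x a with hxa | hxa
    · rw [hH0 x hxa]; exact zero_le
    · have hi := h.integrable_gwStep_rpow n x hq0.le hq1
      refine le_trans (ENNReal.ofReal_le_ofReal ?_)
        (ofReal_integral_le_lintegral_ofReal (hi.sub (integrable_const ((a : ℝ) ^ q))))
      rw [integral_sub hi (integrable_const _), integral_const, probReal_univ, one_smul]
      linarith [hN n x (by omega) (by omega)]
  let w : ℕ → ENNReal := fun n =>
    ∫⁻ ω in gwSurvival ξ I x₀ A n, H (gwImmigration ξ I x₀ n ω) ∂μ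
  have hw : Monotone w := by
    refine monotone_nat_of_le_succ fun n => ?_
    have hS := h.measurableSet_gwSurvival x₀ A
    calc w n ≤ ∫⁻ ω in gwSurvival ξ I x₀ A n,
          (∫⁻ ω', H (gwStep ξ I n (gwImmigration ξ I x₀ n ω) ω') ∂μ) ∂μ :=
          lintegral_mono fun ω => hΦ n _
      _ = ∫⁻ ω in gwSurvival ξ I x₀ A n, H (gwImmigration ξ I x₀ (n + 1) ω) ∂μ :=
          (h.setLIntegral_gwImmigration_succ x₀ n
            (measurableSet_gwSurvival_gwSigma ξ I x₀ A n) H).symm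
      _ ≤ w (n + 1) := by
          simp only [w]
          rw [← lintegral_indicator (hS n), ← lintegral_indicator (hS (n + 1))]
          refine lintegral_mono fun ω => ?_
          by_cases hω : ω ∈ gwSurvival ξ I x₀ A n
          · by_cases hω' : ω ∈ gwSurvival ξ I x₀ A (n + 1)
            · simp [hω, hω']
            · have : (gwImmigration ξ I x₀ (n + 1) ω : ℝ) ≤ A := by
                by_contra hcon
                exact hω' (by rw [gwSurvival_succ]; exact ⟨hω, not_le.1 hcon⟩)
              have h1 : gwImmigration ξ I x₀ (n + 1) ω ≤ a := by
                exact_mod_cast this.trans haN.2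
              simp [hω, hω', hH0 _ h1]
          · simp [hω]
  -- By climbing at least one unit per generation, the process is above a at time a + 1 with
  -- positive probability.
  have hpos : 0 < w (a + 1) := by
    have hmeas : Measurable fun ω => H (gwImmigration ξ I x₀ (a + 1) ω) :=
      (Measurable.of_discrete (f := H)).comp (h.measurable_gwImmigration x₀ (a + 1))
    simp only [w]
    rw [setLIntegral_pos_iff hmeas]
    refine (h.measure_gwSurvival_inter_pos hc hx₀ (a + 1)).trans_le
      (measure_mono fun ω hω => ⟨(hHpos _ ?_).ne', hω.1⟩)
    have : x₀ + (a + 1) ≤ gwImmigration ξ I x₀ (a + 1) ω := hω.2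
    omega
  obtain ⟨g, hg0, hg⟩ := ENNReal.lt_iff_exists_nnreal_btwn.1 hpos
  refine ⟨g, by exact_mod_cast hg0, a + 1, by omega, fun n hn => ?_⟩
  rw [ENNReal.ofReal_coe_nnreal]
  refine (hg.le.trans (hw hn)).trans (lintegral_mono fun ω => ENNReal.ofReal_le_ofReal ?_)
  have : (0 : ℝ) ≤ (a : ℝ) ^ q := by positivity
  linarith

-- Pointwise x^q ≤ L^q + L^(q-1) x, according to whether x ≤ L or x ≥ L.
omit [IsProbabilityMeasure μ] in
theorem setLIntegral_rpow_le (h : IsCriticalGW μ ξ I c d) (x₀ : ℕ) (A : ℝ) {q L : ℝ} (hq0 : 0 ≤ q)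
    (hq1 : q ≤ 1) (hL : 0 < L) (n : ℕ) :
    ∫⁻ ω in gwSurvival ξ I x₀ A n, ENNReal.ofReal ((gwImmigration ξ I x₀ n ω : ℝ) ^ q) ∂μ ≤
      ENNReal.ofReal (L ^ q) * μ (gwSurvival ξ I x₀ A n) + ENNReal.ofReal (L ^ (q - 1)) *
        ∫⁻ ω in gwSurvival ξ I x₀ A n, (gwImmigration ξ I x₀ n ω : ENNReal) ∂μ := by
  have hm : Measurable fun ω => (gwImmigration ξ I x₀ n ω : ENNReal) :=
    (Measurable.of_discrete (f := fun m : ℕ => (m : ENNReal))).comp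
      (h.measurable_gwImmigration x₀ n)
  rw [← setLIntegral_const, ← lintegral_const_mul _ hm, ← lintegral_add_left measurable_const]
  refine lintegral_mono fun ω => ?_
  set x := gwImmigration ξ I x₀ n ω
  have hx0 : (0 : ℝ) ≤ x := Nat.cast_nonneg x
  rw [← ENNReal.ofReal_natCast, ← ENNReal.ofReal_mul (by positivity),
    ← ENNReal.ofReal_add (by positivity) (by positivity)]
  refine ENNReal.ofReal_le_ofReal ?_
  rcases le_total (x : ℝ) L with hx | hx
  · have h1 := Real.rpow_le_rpow hx0 hx hq0
    have : 0 ≤ L ^ (q - 1) * x := by positivity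
    linarith
  · have hx' : (0 : ℝ) < x := hL.trans_le hx
    have h1 : (x : ℝ) ^ (q - 1) ≤ L ^ (q - 1) :=
      Real.rpow_le_rpow_of_nonpos hL hx (by linarith)
    have h2 : (x : ℝ) ^ q = (x : ℝ) ^ (q - 1) * x := by
      rw [Real.rpow_sub_one hx'.ne']; field_simp
    have h3 : 0 ≤ L ^ q := by positivity
    rw [h2]
    nlinarith

theorem exists_le_measureReal_gwSurvival (h : IsCriticalGW μ ξ I c d) (hc : 0 < c) {x₀ : ℕ} {A : ℝ}
    (hA : 0 ≤ A) (hx₀ : A < x₀) {p q D : ℝ} (hp1 : p ≤ 1) (hq0 : 0 < q) (hq1 : q < 1) {N : ℕ}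
    (hD : ∀ n : ℕ, 1 ≤ n → ∑ k ∈ Finset.range n, μ.real (gwSurvival ξ I x₀ A k) ≤
      D * (n : ℝ) ^ (1 - p))
    (hN : ∀ n x : ℕ, 1 ≤ x → N ≤ x → (x : ℝ) ^ q ≤ ∫ ω, (gwStep ξ I n x ω : ℝ) ^ q ∂μ) :
    ∃ C : ℝ, 0 < C ∧ ∀ n : ℕ, 1 ≤ n →
      C * (n : ℝ) ^ (-(q * (1 - p) / (1 - q))) ≤ μ.real (gwSurvival ξ I x₀ A n) := by
  obtain ⟨g, hg, m, hm, hgm⟩ := h.exists_le_setLIntegral_rpow hc hx₀ hq0 hq1.le hN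
  have hD0 : 0 ≤ D := by
    have h1 := hD 1 le_rfl
    have h2 : 0 ≤ ∑ k ∈ Finset.range 1, μ.real (gwSurvival ξ I x₀ A k) := by positivity
    simp only [Nat.cast_one, Real.one_rpow, mul_one] at h1
    linarith
  set E := (x₀ : ℝ) + c * D with hE
  have hE0 : 0 < E := by
    have : 0 < (x₀ : ℝ) := hA.trans_lt hx₀
    positivity
  have hlarge : ∀ n : ℕ, 1 ≤ n → m ≤ n →
      g / 2 * (2 * E / g) ^ (-(q / (1 - q))) * (n : ℝ) ^ (-(q * (1 - p) / (1 - q))) ≤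
        μ.real (gwSurvival ξ I x₀ A n) := by
    intro n hn hmn
    have hn0 : (0 : ℝ) < n := by exact_mod_cast hn
    set T := (n : ℝ) ^ (1 - p) with hT
    have hT0 : 0 < T := by positivity
    have hT1 : 1 ≤ T := Real.one_le_rpow (by exact_mod_cast hn) (by linarith)
    have hmean := h.setLIntegral_gwImmigration_le hc.le hx₀ n
    have hmean' : ∫⁻ ω in gwSurvival ξ I x₀ A n, (gwImmigration ξ I x₀ n ω : ENNReal) ∂μ ≤
        ENNReal.ofReal (E * T) := by
      refine hmean.trans (ENNReal.ofReal_le_ofReal ?_)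
      have h1 := mul_le_mul_of_nonneg_left (hD n hn) hc.le
      have h2 : (x₀ : ℝ) ≤ x₀ * T := le_mul_of_one_le_right (Nat.cast_nonneg _) hT1
      rw [hE]; linarith
    set b := 2 * E * T / g with hb
    have hb0 : 0 < b := by positivity
    have h1q : 0 < 1 - q := by linarith
    -- This L solves L^(q-1) E T = g/2, so the first-moment term uses half of g and L^q P(τ > n)
    -- must supply the other half.
    set L := b ^ (1 / (1 - q)) with hL
    have hL0 : 0 < L := by positivity
    have hLq1 : L ^ (q - 1) = b⁻¹ := by
      rw [hL, ← Real.rpow_mul hb0.le, show 1 / (1 - q) * (q - 1) = -1 by field_simp; ring,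
        Real.rpow_neg_one]
    have hLq : L ^ q = b ^ (q / (1 - q)) := by
      rw [hL, ← Real.rpow_mul hb0.le]; congr 1; ring
    have h3 := (hgm n hmn).trans (h.setLIntegral_rpow_le x₀ A hq0.le hq1.le hL0 n)
    have h4 : ENNReal.ofReal g ≤ ENNReal.ofReal
        (L ^ q * μ.real (gwSurvival ξ I x₀ A n) + L ^ (q - 1) * (E * T)) := by
      refine h3.trans ?_
      rw [ENNReal.ofReal_add (by positivity) (by positivity), ENNReal.ofReal_mul (by positivity),
        ENNReal.ofReal_mul (by positivity), ofReal_measureReal]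
      gcongr
    have h5 := (ENNReal.ofReal_le_ofReal_iff (by positivity)).1 h4
    have h6 : L ^ (q - 1) * (E * T) = g / 2 := by
      rw [hLq1, hb]; field_simp
    have h7 : g / 2 ≤ b ^ (q / (1 - q)) * μ.real (gwSurvival ξ I x₀ A n) := by
      rw [← hLq]; linarith
    have h8 : (2 * E / g) ^ (-(q / (1 - q))) * (n : ℝ) ^ (-(q * (1 - p) / (1 - q))) =
        b ^ (-(q / (1 - q))) := by
      rw [hb, show 2 * E * T / g = 2 * E / g * T by ring,
        Real.mul_rpow (by positivity) hT0.le, hT, ← Real.rpow_mul hn0.le]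
      congr 2; ring
    rw [mul_assoc, h8, Real.rpow_neg hb0.le, ← div_eq_mul_inv, div_le_iff₀ (by positivity)]
    linarith
  refine ⟨g / 2 * (2 * E / g) ^ (-(q / (1 - q))) * (m : ℝ) ^ (-(q * (1 - p) / (1 - q))), ?_,
    fun n hn => ?_⟩
  · have : (0 : ℝ) < m := by exact_mod_cast hm
    positivity
  -- The bound for times at least m is used at time mn, and survival up to mn implies survival up to
  -- n. The constant absorbs the power of m.
  · have h1 := hlarge (m * n) (Nat.mul_pos hm hn) (Nat.le_mul_of_pos_right m hn)
    rw [Nat.cast_mul, Real.mul_rpow (by positivity) (by positivity), ← mul_assoc] at h1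
    exact h1.trans (measureReal_mono (gwSurvival_antitone ξ I x₀ A (Nat.le_mul_of_pos_left n hm)))

end IsCriticalGW

/-! ### Choice of exponents and conclusion. -/

-- At ε = 0 the quotient equals s, and it is continuous there because s < 1.
open Filter Topology in
theorem exists_exponents_near {s β : ℝ} (hs0 : 0 < s) (hs1 : s < 1) (hβ : s < β) :
    ∃ ε : ℝ, 0 < ε ∧ ε ≤ s / 2 ∧ s + ε < 1 ∧ (s + ε) * (1 - (s - ε)) / (1 - (s + ε)) < β := by
  have hcont : ContinuousAt (fun ε : ℝ => (s + ε) * (1 - (s - ε)) / (1 - (s + ε))) 0 := by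
    refine ContinuousAt.div (by fun_prop) (by fun_prop) ?_
    simp; linarith
  have h0 : (s + 0) * (1 - (s - 0)) / (1 - (s + 0)) < β := by
    rw [add_zero, sub_zero, mul_div_assoc, div_self (by linarith), mul_one]; exact hβ
  have h1 := hcont.eventually_lt_const h0
  have h2 : ∀ᶠ ε : ℝ in 𝓝 0, ε < min (s / 2) (1 - s) :=
    eventually_lt_nhds (lt_min (by linarith) (by linarith))
  obtain ⟨ε, ⟨h3, h4⟩, h5⟩ := (((h1.and h2).filter_mono nhdsWithin_le_nhds).and
    (self_mem_nhdsWithin (s := Set.Ioi (0 : ℝ)))).exists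
  exact ⟨ε, h5, (h4.trans_le (min_le_left _ _)).le, by linarith [h4.trans_le (min_le_right _ _)],
    h3⟩

theorem IsCriticalGW.exists_measureReal_gwSurvival_bounds {Ω : Type*} [MeasurableSpace Ω]
    {μ : Measure Ω} [IsProbabilityMeasure μ] {ξ : ℕ → ℕ → Ω → ℕ} {I : ℕ → Ω → ℕ} {c d : ℝ}
    (h : IsCriticalGW μ ξ I c d) (hc : 0 < c) (hd : 0 < d) (hθ : 2 * c / d < 1) :
    ∃ A : ℝ, 0 < A ∧ ∀ x₀ : ℕ, A < (x₀ : ℝ) →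
      ∀ α β : ℝ, α < 1 - 2 * c / d → 1 - 2 * c / d < β →
        ∃ Cα Cβ : ℝ, 0 < Cα ∧ 0 < Cβ ∧ ∀ n : ℕ, 1 ≤ n →
          Cβ / (n : ℝ) ^ β ≤ μ.real (gwSurvival ξ I x₀ A n) ∧
            μ.real (gwSurvival ξ I x₀ A n) ≤ Cα / (n : ℝ) ^ α := by
  set s := 1 - 2 * c / d with hs
  have hs0 : 0 < s := by linarith
  have hs1 : s < 1 := by
    have : 0 < 2 * c / d := by positivity
    linarith
  obtain ⟨N₀, κ₀, hκ₀, h₀⟩ :=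
    h.exists_rpow_drift_neg hd (half_pos hs0) (by linarith) (half_lt_self hs0)
  -- A depends only on the drift threshold of the single power s/2, hence not on α or β.
  refine ⟨(N₀ : ℝ) + 1, by positivity, fun x₀ hx₀ α β hα hβ => ?_⟩
  have hA : (0 : ℝ) ≤ (N₀ : ℝ) + 1 := by positivity
  have hsum : ∀ p : ℝ, s / 2 ≤ p → p < s → ∃ D : ℝ, 0 < D ∧ ∀ n : ℕ, 1 ≤ n →
      ∑ k ∈ Finset.range n, μ.real (gwSurvival ξ I x₀ (N₀ + 1) k) ≤ D * (n : ℝ) ^ (1 - p) := by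
    intro p hp hps
    have hp0 : 0 < p := by linarith
    obtain ⟨K, κ, hK, hκ, hdrift⟩ :=
      h.exists_lyapunov hd (half_pos hs0) hp (by linarith) hps hκ₀ h₀
    have hx0 : (0 : ℝ) < x₀ := hA.trans_lt hx₀
    refine ⟨_, ?_, fun n hn => h.sum_gwSurvival_le hA hx₀ hp0.le (by linarith) hκ
      (W := fun x => (x : ℝ) ^ p + K * (x : ℝ) ^ (s / 2)) (fun x => by positivity)
      (fun x => le_add_of_nonneg_right (by positivity))
      (fun n x => (h.integrable_gwStep_rpow n x hp0.le (by linarith)).add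
        ((h.integrable_gwStep_rpow n x (by linarith) (by linarith)).const_mul K))
      (fun n x hx => ?_) hn⟩
    · positivity
    · have hx' : N₀ + 1 < x := by exact_mod_cast hx
      exact hdrift n x (by omega) (by omega)
  have hupper : ∃ Cα : ℝ, 0 < Cα ∧ ∀ n : ℕ, 1 ≤ n →
      μ.real (gwSurvival ξ I x₀ (N₀ + 1) n) ≤ Cα / (n : ℝ) ^ α := by
    -- The Lyapunov function requires an exponent of at least s/2. A smaller, possibly negative, α
    -- only weakens the bound.
    obtain ⟨D, hD0, hD⟩ := hsum (max α (s / 2)) (le_max_right _ _) (max_lt hα (half_lt_self hs0))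
    refine ⟨D, hD0, fun n hn => ?_⟩
    have hn1 : (1 : ℝ) ≤ n := by exact_mod_cast hn
    have hn0 : (0 : ℝ) < n := by linarith
    have h1 : (n : ℝ) * μ.real (gwSurvival ξ I x₀ (N₀ + 1) n) ≤
        ∑ k ∈ Finset.range n, μ.real (gwSurvival ξ I x₀ (N₀ + 1) k) := by
      rw [← nsmul_eq_mul, ← Finset.card_range n, ← Finset.sum_const, Finset.card_range]
      exact Finset.sum_le_sum fun k hk => measureReal_mono
        (gwSurvival_antitone ξ I x₀ _ (Finset.mem_range.1 hk).le)
    have h2 := h1.trans (hD n hn)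
    rw [le_div_iff₀ (by positivity)]
    have h3 : (n : ℝ) ^ α ≤ (n : ℝ) ^ max α (s / 2) :=
      Real.rpow_le_rpow_of_exponent_le hn1 (le_max_left _ _)
    have h4 : (n : ℝ) ^ (1 - max α (s / 2)) = n / (n : ℝ) ^ max α (s / 2) := by
      rw [Real.rpow_sub hn0, Real.rpow_one]
    rw [h4, ← mul_div_assoc, le_div_iff₀ (by positivity)] at h2
    have h5 : μ.real (gwSurvival ξ I x₀ (N₀ + 1) n) * (n : ℝ) ^ max α (s / 2) ≤ D := by
      refine le_of_mul_le_mul_left ?_ hn0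
      linarith
    exact (mul_le_mul_of_nonneg_left h3 measureReal_nonneg).trans h5
  have hlower : ∃ Cβ : ℝ, 0 < Cβ ∧ ∀ n : ℕ, 1 ≤ n →
      Cβ / (n : ℝ) ^ β ≤ μ.real (gwSurvival ξ I x₀ (N₀ + 1) n) := by
    obtain ⟨ε, hε0, hεs, hε1, hεβ⟩ := exists_exponents_near hs0 hs1 hβ
    obtain ⟨D, hD0, hD⟩ := hsum (s - ε) (by linarith) (by linarith)
    obtain ⟨N, hN⟩ := h.exists_rpow_drift_pos hd (p := s + ε) (by linarith) hε1 (by linarith)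
    obtain ⟨C, hC0, hC⟩ := h.exists_le_measureReal_gwSurvival hc hA hx₀ (by linarith)
      (by linarith) hε1 hD hN
    refine ⟨C, hC0, fun n hn => le_trans ?_ (hC n hn)⟩
    have hn1 : (1 : ℝ) ≤ n := by exact_mod_cast hn
    rw [div_eq_mul_inv, ← Real.rpow_neg (by linarith)]
    gcongr
  obtain ⟨Cα, hCα, hα'⟩ := hupper
  obtain ⟨Cβ, hCβ, hβ'⟩ := hlower
  exact ⟨Cα, Cβ, hCα, hCβ, fun n hn => ⟨hβ' n hn, hα' n hn⟩⟩

theorem mainTheorem4 {Ω : Type*} [MeasurableSpace Ω] (μ : Measure Ω) [IsProbabilityMeasure μ]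
    (ξ : ℕ → ℕ → Ω → ℕ) (I : ℕ → Ω → ℕ) (c d δ : ℝ)
    (hξ_meas : ∀ k n, Measurable (ξ k n)) (hI_meas : ∀ n, Measurable (I n))
    -- the offspring numbers are i.i.d., the immigration numbers are i.i.d.,
    -- and the two families are independent
    (hξ_indep : iIndepFun (fun p : ℕ × ℕ => ξ p.1 p.2) μ)
    (hξ_ident : ∀ k n, IdentDistrib (ξ k n) (ξ 1 1) μ μ)
    (hI_indep : iIndepFun I μ)
    (hI_ident : ∀ n, IdentDistrib (I n) (I 1) μ μ)
    (hξI : IndepFun (fun ω (p : ℕ × ℕ) => ξ p.1 p.2 ω) (fun ω (n : ℕ) => I n ω) μ)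
    -- moment assumptions
    (hδ : 0 < δ)
    (hξ_moment : Integrable (fun ω => (ξ 1 1 ω : ℝ) ^ (2 + δ)) μ)
    (hI_moment : Integrable (fun ω => (I 1 ω : ℝ) ^ (2 + δ)) μ)
    (hξ_mean : ∫ ω, (ξ 1 1 ω : ℝ) ∂μ = 1)
    (hξ_var : variance (fun ω => (ξ 1 1 ω : ℝ)) μ = d) (hd : 0 < d)
    (hI_mean : ∫ ω, (I 1 ω : ℝ) ∂μ = c) (hc : 0 < c)
    (hθ : 2 * c / d < 1) :
    ∃ A : ℝ, 0 < A ∧ ∀ x₀ : ℕ, A < (x₀ : ℝ) →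
      ∀ α β : ℝ, α < 1 - 2 * c / d → 1 - 2 * c / d < β →
        ∃ Cα Cβ : ℝ, 0 < Cα ∧ 0 < Cβ ∧ ∀ n : ℕ, 1 ≤ n →
          Cβ / (n : ℝ) ^ β ≤
              μ.real {ω | ((n : ℕ) : WithTop ℕ) < hitBelow (gwImmigration ξ I x₀) A ω} ∧
            μ.real {ω | ((n : ℕ) : WithTop ℕ) < hitBelow (gwImmigration ξ I x₀) A ω} ≤
              Cα / (n : ℝ) ^ α := by
  have hξ2 := memLp_two_of_integrable_rpow (hξ_meas 1 1) hδ.le hξ_moment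
  have h : IsCriticalGW μ ξ I c d :=
    { measurable := by rintro (⟨k, n⟩ | n); exacts [hξ_meas k n, hI_meas n]
      indep := iIndepFun_sumElim hξ_indep hI_indep hξI
      offspring_ident := hξ_ident
      immigration_ident := hI_ident
      offspring_memLp := hξ2
      immigration_memLp := memLp_two_of_integrable_rpow (hI_meas 1) hδ.le hI_moment
      offspring_mean := hξ_mean
      offspring_var := by
        rw [← hξ_var, variance_eq_integral hξ2.1.aemeasurable, hξ_mean]
      immigration_mean := hI_mean }
  simp only [lt_hitBelow_iff, Set.ofPred_mem_eq]
  exact h.exists_measureReal_gwSurvival_bounds hc hd hθ
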